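/- Let $d\ge 2$ and consider $\mathbb Z^d$ with edges $E(\mathbb Z^d)$ between points at Euclidean distance $1$. Let $Q$ be a probability measure on $\mathbb R$ such that $0$ is an interior point of the support of $Q$, and let $J=(J_e)_{e\in E(\mathbb Z^d)}$ be i.i.d. random variables with law $Q$. For $L\in\mathbb N$ let $\Lambda_L=[-L,L]^d\cap\mathbb Z^d$, let $E(\Lambda_L)$ be the set of edges with both endpoints in $\Lambda_L$, let $\Omega_L=\{-1,1\}^{\Lambda_L}$, and for $\beta>0$ let $$\pi_L(\sigma)=\frac1{Z_L}\exp\Big(\beta\sum_{\{x,y\}\in E(\Lambda_L)}J_{xy}\sigma_x\sigma_y\Big),\qquad \sigma\in\Omega_L,$$ be the Ising measure. The Swendsen–Wang chain is the Markov chain on $\Omega_L$ whose transition matrix $M_L$ is given by the following two steps from $\sigma$. (1) Independently for each edge $e=\{x,y\}\in E(\Lambda_L)$ with $J_e\sigma_x\sigma_y\ge 0$, open $e$ with probability $p_e=1-e^{-2\beta|J_e|}$; all other edges are closed. (2) For each connected component of the graph formed by $\Lambda_L$ and the open edges, choose the spin at one of its vertices to be $\pm1$ with probability $1/2$ each, independently,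 and determine the other spins of the component by the rule $J_e\sigma'_x\sigma'_y\ge 0$ on every open edge $e=\{x,y\}$. Let $1=\lambda_0,\lambda_1,\dots,\lambda_n$ be the eigenvalues of $M_L$, with multiplicity, and put $R_L=\sup_{i>0}|\lambda_i|$. For $f:\Omega_L\to\mathbb R$ and $t\in\mathbb N$ let $$C_{ff}(t)=\sum_{\omega,\tilde\omega}f(\omega)f(\tilde\omega)\pi_L(\omega)M_L^t(\omega,\tilde\omega)-\Big(\sum_\omega f(\omega)\pi_L(\omega)\Big)^2,\qquad \rho_{ff}(t)=\frac{C_{ff}(t)}{C_{ff}(0)},$$ and let $$\tau_{\exp,L}=\sup_{f:\,C_{ff}(0)\ne0}\ \limsup_{t\to\infty}\frac{t}{-\log|\rho_{ff}(t)|}\in[0,\infty]$$ (with $-\log 0=\infty$, $t/\infty=0$, and $t/0=\infty$ for $t>0$). Then for every $\delta\in(0,1/2)$ there is $\tilde\beta(\delta)\in(0,\infty)$, depending only on $\delta$, $d$ and $Q$, such that for every $\beta>\tilde\beta(\delta)$, almost surely with respect to $J$, $$\lim_{L\to\infty}R_L=1\qquad\text{and}\qquad\lim_{L\to\infty}\tau_{\exp,L}=\infty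 .$$ -/

import Mathlib

noncomputable section

open scoped Classical ENNReal

namespace SwendsenWang

section Lattice

/-- The nearest-neighbour graph on `ℤ^d`: edges join points at Euclidean distance one. -/
def latticeGraph (d : ℕ) : SimpleGraph (Fin d → ℤ) where
  Adj x y := ∑ i, (x i - y i) ^ 2 = 1
  symm := ⟨fun x y h => by
    rw [← h]
    exact Finset.sum_congr rfl fun i _ => by ring⟩
  loopless := ⟨fun x h => by simp at h⟩

/-- The box `Λ_L = [-L, L]^d ∩ ℤ^d`. -/
def box (d L : ℕ) : Finset (Fin d → ℤ) :=
  Finset.Icc (fun _ => -(L : ℤ)) (fun _ => (L : ℤ))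

/-- The graph `(Λ_L, E(Λ_L))`. -/
def boxGraph (d L : ℕ) : SimpleGraph {x // x ∈ box d L} :=
  (latticeGraph d).comap (Function.Embedding.subtype _)

/-- The couplings on the edges of the box, read off from couplings on all of `ℤ^d`. -/
def boxCouplings {d : ℕ} (J : (latticeGraph d).edgeSet → ℝ) (L : ℕ) :
    (boxGraph d L).edgeSet → ℝ :=
  fun e => J ((SimpleGraph.Embedding.comap (Function.Embedding.subtype _)
    (latticeGraph d)).mapEdgeSet e)

end Lattice

section Ising

variable {V : Type*} [Fintype V] (G : SimpleGraph V) (J : G.edgeSet → ℝ) (β : ℝ)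

/-- Spin configurations, with values in `{-1, 1} = ℤˣ`. -/
abbrev Spins (V : Type*) : Type _ := V → ℤˣ

/-- The product `σ_x σ_y` along the edge `{x, y}`. -/
def edgeSpin {V : Type*} (σ : Spins V) (e : Sym2 V) : ℝ := (((e.map σ).mul : ℤˣ) : ℤ)

/-- `H(σ) = - ∑_{x,y} J_{xy} σ_x σ_y`, each edge of the graph being counted once. -/
def hamiltonian (σ : Spins V) : ℝ := -∑ e : G.edgeSet, J e * edgeSpin σ e

/-- The Ising (Gibbs) measure at inverse temperature `β`. -/
def gibbs (σ : Spins V) : ℝ :=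
  Real.exp (-β * hamiltonian G J σ) / ∑ ω : Spins V, Real.exp (-β * hamiltonian G J ω)

/-- The probability with which an edge with `J_e σ_x σ_y ≥ 0` is opened. -/
def bondProb (e : G.edgeSet) : ℝ := 1 - Real.exp (-2 * β * |J e|)

/-- First half-step: the probability of producing the edge configuration `η` from the spins `σ`.
Edges with `J_e σ_x σ_y ≥ 0` are opened independently with probability `bondProb e`;
all other edges are closed. -/
def bondStep (σ : Spins V) (η : G.edgeSet → Bool) : ℝ :=
  ∏ e : G.edgeSet,
    if 0 ≤ J e * edgeSpin σ e then
      (if η e = true then bondProb G J β e else 1 - bondProb G J β e)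
    else (if η e = true then 0 else 1)

/-- The graph on the vertices formed by the open edges; its connected components are the
clusters of `η`. -/
def openGraph {V : Type*} (G : SimpleGraph V) (η : G.edgeSet → Bool) : SimpleGraph V :=
  SimpleGraph.fromEdgeSet {e | ∃ h : e ∈ G.edgeSet, η ⟨e, h⟩ = true}

/-- Second half-step: the probability of producing the spins `σ` from the edge configuration `η`.
One fair coin is tossed per cluster, and the rule `J_e σ_x σ_y ≥ 0` on open edges propagates its
value through the cluster. So each of the configurations obeying the rule has probability
`2^{-#clusters}`. (Open edges have `J_e ≠ 0` with probability one.) -/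
def spinStep (η : G.edgeSet → Bool) (σ : Spins V) : ℝ :=
  if ∀ e : G.edgeSet, η e = true → 0 ≤ J e * edgeSpin σ e then
    (1 / 2 : ℝ) ^ Nat.card (openGraph G η).ConnectedComponent
  else 0

/-- The Swendsen–Wang transition matrix on spin configurations. -/
def swMatrix : Matrix (Spins V) (Spins V) ℝ :=
  fun σ σ' => ∑ η : G.edgeSet → Bool, bondStep G J β σ η * spinStep G J η σ'

end Ising

section Markov

variable {S : Type*} [Fintype S]

/-- `R = sup_{i > 0} |λ_i|`, where `λ_0 = 1, λ_1, …` are the eigenvalues of the transition matrix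
`P` with multiplicity (one copy of the eigenvalue `1` is left out). -/
def secondSpectralRadius (P : Matrix S S ℝ) : ℝ :=
  sSup ((fun z : ℂ => ‖z‖) '' {z | z ∈ (P.map (fun a : ℝ => (a : ℂ))).charpoly.roots.erase 1})

/-- The autocorrelation function `C_ff(t)` of the chain with transition matrix `P` started from
`π`. -/
def autocorr (P : Matrix S S ℝ) (π : S → ℝ) (f : S → ℝ) (t : ℕ) : ℝ :=
  ∑ ω, ∑ ω', f ω * f ω' * π ω * (P ^ t) ω ω' - (∑ ω, f ω * π ω) ^ 2

/-- The normalized autocorrelation function `ρ_ff(t) = C_ff(t) / C_ff(0)`. -/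
def normAutocorr (P : Matrix S S ℝ) (π : S → ℝ) (f : S → ℝ) (t : ℕ) : ℝ :=
  autocorr P π f t / autocorr P π f 0

/-- `τ_{exp,f} = limsup_t t / (-log |ρ_ff(t)|)` in `[0, ∞]`, with `-log 0 = ∞`, `t / ∞ = 0` and
`t / 0 = ∞` for `t > 0`. -/
def expTimeOf (P : Matrix S S ℝ) (π : S → ℝ) (f : S → ℝ) : ℝ≥0∞ :=
  Filter.limsup
    (fun t : ℕ => (t : ℝ≥0∞) /
      (-ENNReal.log (ENNReal.ofReal |normAutocorr P π f t|)).toENNReal) Filter.atTop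

/-- `τ_exp`, the supremum of `τ_{exp,f}` over all `f` of nonzero variance `C_ff(0)`. -/
def expTime (P : Matrix S S ℝ) (π : S → ℝ) : ℝ≥0∞ :=
  ⨆ (f : S → ℝ) (_ : autocorr P π f 0 ≠ 0), expTimeOf P π f

end Markov

/-- `R_L`. -/
def boxSpectralRadius {d : ℕ} (J : (latticeGraph d).edgeSet → ℝ) (β : ℝ) (L : ℕ) : ℝ :=
  secondSpectralRadius (swMatrix (boxGraph d L) (boxCouplings J L) β)

/-- `τ_{exp,L}`. -/
def boxExpTime {d : ℕ} (J : (latticeGraph d).edgeSet → ℝ) (β : ℝ) (L : ℕ) : ℝ≥0∞ :=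
  expTime (swMatrix (boxGraph d L) (boxCouplings J L) β)
    (gibbs (boxGraph d L) (boxCouplings J L) β)

end SwendsenWang

end

/-!
Take two adjacent `n × n` squares in a coordinate plane with strong ferromagnetic couplings,
joined by `n` links of strength `M / (n β)`, half of them ferromagnetic and half
antiferromagnetic, and with all other couplings touching the squares almost zero. This is a finite
pattern of positive probability, so by independence (Borel–Cantelli) it almost surely occurs
somewhere, and then in every large box.

Because the signs of the links cancel, the two squares are aligned with probability about `1/2`.
A Swendsen–Wang step can change this only if no open link joins the clusters which carry the two
squares. A multiscale argument shows that these clusters reach most endpoints of the links: a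
strong edge is closed with probability at most `2 ^ (-84)` given the other edges, and a square of
subsquares is good when all but at most one of its subsquares are, and neighbouring ones of these
are linked. So the conductance of the event "aligned" is at most of order `exp (-c M)`, which puts
an eigenvalue within that order of `1`; now let `M → ∞`.
-/

noncomputable section

open scoped Classical ENNReal

namespace SwendsenWang

/-! ### Reversible chains and bottlenecks -/

section ReversibleChains

open Filter

variable {S : Type*} [Fintype S] {P : Matrix S S ℝ} {π f : S → ℝ} {μ c : ℝ}

/-- `P` is a stochastic matrix, reversible with respect to the positive probability vector `π`. -/
structure IsReversibleChain (P : Matrix S S ℝ) (π : S → ℝ) : Prop where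
  pos : ∀ x, 0 < π x
  sum_eq_one : ∑ x, π x = 1
  nonneg : ∀ x y, 0 ≤ P x y
  row_sum : ∀ x, ∑ y, P x y = 1
  reversible : ∀ x y, π x * P x y = π y * P y x

namespace IsReversibleChain

theorem norm_le_one_of_mem_roots (h : IsReversibleChain P π) {z : ℂ}
    (hz : z ∈ (P.map (fun a : ℝ => (a : ℂ))).charpoly.roots) : ‖z‖ ≤ 1 := by
  have hev : Module.End.HasEigenvalue (Matrix.toLin' (P.map (fun a : ℝ => (a : ℂ)))) z := by
    rw [Module.End.hasEigenvalue_iff_isRoot_charpoly, Matrix.charpoly_toLin']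
    exact Polynomial.isRoot_of_mem_roots hz
  have hnorm : ∀ x y, ‖P.map (fun a : ℝ => (a : ℂ)) x y‖ = P x y := fun x y => by
    rw [Matrix.map_apply, Complex.norm_real, Real.norm_of_nonneg (h.nonneg x y)]
  obtain ⟨x, hx⟩ := eigenvalue_mem_ball hev
  simp only [mem_closedBall_iff_norm, hnorm] at hx
  calc ‖z‖ ≤ ‖z - P.map (fun a : ℝ => (a : ℂ)) x x‖ + ‖P.map (fun a : ℝ => (a : ℂ)) x x‖ := by
        simpa only [sub_add_cancel] using
          norm_add_le (z - P.map (fun a : ℝ => (a : ℂ)) x x) (P.map (fun a : ℝ => (a : ℂ)) x x)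
    _ ≤ ∑ y ∈ Finset.univ.erase x, P x y + P x x := by rw [hnorm]; gcongr
    _ = 1 := by rw [Finset.sum_erase_add _ _ (Finset.mem_univ x), h.row_sum]

theorem norm_le_one_of_mem_erase (h : IsReversibleChain P π) :
    ∀ r ∈ (fun z : ℂ => ‖z‖) ''
      {z | z ∈ (P.map (fun a : ℝ => (a : ℂ))).charpoly.roots.erase 1}, r ≤ 1 := by
  rintro _ ⟨z, hz, rfl⟩
  exact h.norm_le_one_of_mem_roots (Multiset.mem_of_mem_erase hz)

theorem secondSpectralRadius_le_one (h : IsReversibleChain P π) : secondSpectralRadius P ≤ 1 :=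
  Real.sSup_le h.norm_le_one_of_mem_erase zero_le_one

theorem two_le_finrank_eigenspace_one (h : IsReversibleChain P π) (hf : f ≠ 0)
    (hmean : ∑ x, π x * f x = 0) (hev : P.mulVec f = f) :
    2 ≤ Module.finrank ℝ (Module.End.eigenspace (Matrix.toLin' P) 1) := by
  have hone : (1 : S → ℝ) ≠ 0 := by
    obtain ⟨x, -⟩ := Function.ne_iff.mp hf
    exact fun h0 => one_ne_zero (congrFun h0 x)
  have hlt : ℝ ∙ (1 : S → ℝ) < Module.End.eigenspace (Matrix.toLin' P) 1 := by
    refine SetLike.lt_iff_le_and_exists.mpr ⟨?_, f, ?_, ?_⟩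
    · rw [Submodule.span_singleton_le_iff_mem, Module.End.mem_eigenspace_iff]
      ext x
      simp [Matrix.mulVec, dotProduct, h.row_sum]
    · simpa [Module.End.mem_eigenspace_iff] using hev
    · rintro hmem
      obtain ⟨t, rfl⟩ := Submodule.mem_span_singleton.mp hmem
      have ht : t = 0 := by simpa [← Finset.sum_mul, h.sum_eq_one] using hmean
      exact hf (by simp [ht])
  have := Submodule.finrank_lt_finrank_of_lt hlt
  rwa [finrank_span_singleton hone] at this

theorem mem_roots_erase_one (h : IsReversibleChain P π) (hf : f ≠ 0)
    (hmean : ∑ x, π x * f x = 0) (hev : P.mulVec f = μ • f) : μ ∈ P.charpoly.roots.erase 1 := by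
  by_cases hμ : μ = 1
  · subst hμ
    have hcount := (h.two_le_finrank_eigenspace_one hf hmean (by rw [hev, one_smul])).trans
      (LinearMap.finrank_eigenspace_le (Matrix.toLin' P) 1)
    rw [Matrix.charpoly_toLin', ← Polynomial.count_roots] at hcount
    rw [← Multiset.count_pos, Multiset.count_erase_self]
    omega
  · have hvec : Module.End.HasEigenvector (Matrix.toLin' P) μ f :=
      ⟨Module.End.mem_eigenspace_iff.mpr (by rw [Matrix.toLin'_apply, hev]), hf⟩
    rw [Multiset.mem_erase_of_ne hμ, Polynomial.mem_roots P.charpoly_monic.ne_zero,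
      ← Matrix.charpoly_toLin', ← Module.End.hasEigenvalue_iff_isRoot_charpoly]
    exact Module.End.hasEigenvalue_of_hasEigenvector hvec

theorem abs_le_secondSpectralRadius (h : IsReversibleChain P π) (hf : f ≠ 0)
    (hmean : ∑ x, π x * f x = 0) (hev : P.mulVec f = μ • f) : |μ| ≤ secondSpectralRadius P := by
  refine le_csSup ⟨1, h.norm_le_one_of_mem_erase⟩ ⟨μ, ?_, by simp⟩
  have hmap : (P.charpoly.roots.erase 1).map (algebraMap ℝ ℂ) ≤
      (P.map (algebraMap ℝ ℂ)).charpoly.roots.erase 1 := by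
    rw [Multiset.map_erase _ (algebraMap ℝ ℂ).injective, map_one, Matrix.charpoly_map]
    exact Multiset.erase_le_erase 1
      (Polynomial.map_roots_le_of_injective _ (algebraMap ℝ ℂ).injective)
  exact Multiset.mem_of_le hmap
    (Multiset.mem_map_of_mem _ (h.mem_roots_erase_one hf hmean hev))

end IsReversibleChain

theorem pow_mulVec_eq_pow_smul (hev : P.mulVec f = μ • f) (t : ℕ) :
    (P ^ t).mulVec f = μ ^ t • f := by
  induction t with
  | zero => simp
  | succ t ih =>
    rw [pow_succ, ← Matrix.mulVec_mulVec, hev, Matrix.mulVec_smul, ih, smul_smul, pow_succ']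

theorem autocorr_of_eigenvector (hmean : ∑ x, π x * f x = 0) (hev : P.mulVec f = μ • f) (t : ℕ) :
    autocorr P π f t = μ ^ t * ∑ x, π x * f x ^ 2 := by
  have hmean' : ∑ x, f x * π x = 0 := by simpa only [mul_comm] using hmean
  rw [autocorr, hmean', zero_pow two_ne_zero, sub_zero, Finset.mul_sum]
  refine Finset.sum_congr rfl fun x _ => ?_
  calc ∑ y, f x * f y * π x * (P ^ t) x y = f x * π x * (P ^ t).mulVec f x := by
        rw [Matrix.mulVec, dotProduct, Finset.mul_sum]
        exact Finset.sum_congr rfl fun y _ => by ring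
    _ = μ ^ t * (π x * f x ^ 2) := by
        rw [pow_mulVec_eq_pow_smul hev, Pi.smul_apply, smul_eq_mul]; ring

theorem inv_ofReal_neg_log_le_div (hc : 0 < c) (hcμ : c ≤ μ) {t : ℕ} (ht : 0 < t) :
    (ENNReal.ofReal (-Real.log c))⁻¹ ≤
      t / (-ENNReal.log (ENNReal.ofReal (μ ^ t))).toENNReal := by
  have hμ : 0 < μ := hc.trans_le hcμ
  have hlog : (-ENNReal.log (ENNReal.ofReal (μ ^ t))).toENNReal =
      t * ENNReal.ofReal (-Real.log μ) := by
    rw [ENNReal.log_ofReal_of_pos (pow_pos hμ t), ← EReal.coe_neg,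
      EReal.toENNReal_of_ne_top (EReal.coe_ne_top _), EReal.toReal_coe, Real.log_pow,
      ← mul_neg, ENNReal.ofReal_mul (Nat.cast_nonneg t), ENNReal.ofReal_natCast]
  calc (ENNReal.ofReal (-Real.log c))⁻¹ ≤ (ENNReal.ofReal (-Real.log μ))⁻¹ := by
        gcongr
    _ = t / (t * ENNReal.ofReal (-Real.log μ)) := by
        rw [← one_div, ← ENNReal.mul_div_mul_left 1 _ (Nat.cast_ne_zero.mpr ht.ne')
          (ENNReal.natCast_ne_top t), mul_one]
    _ = _ := by rw [hlog]

theorem IsReversibleChain.le_expTime (h : IsReversibleChain P π) (hf : f ≠ 0)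
    (hmean : ∑ x, π x * f x = 0) (hev : P.mulVec f = μ • f) (hc : 0 < c) (hcμ : c ≤ μ) :
    (ENNReal.ofReal (-Real.log c))⁻¹ ≤ expTime P π := by
  have hμ : 0 < μ := hc.trans_le hcμ
  have hvar : ∑ x, π x * f x ^ 2 ≠ 0 := by
    obtain ⟨x, hx⟩ := Function.ne_iff.mp hf
    exact (Finset.sum_pos' (fun y _ => mul_nonneg (h.pos y).le (sq_nonneg _))
      ⟨x, Finset.mem_univ _, mul_pos (h.pos x) (sq_pos_of_ne_zero hx)⟩).ne'
  have hρ : ∀ t, normAutocorr P π f t = μ ^ t := fun t => by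
    rw [normAutocorr, autocorr_of_eigenvector hmean hev, autocorr_of_eigenvector hmean hev,
      pow_zero, one_mul, mul_div_cancel_right₀ _ hvar]
  have hadm : autocorr P π f 0 ≠ 0 := by
    rwa [autocorr_of_eigenvector hmean hev, pow_zero, one_mul]
  refine le_trans ?_ (le_iSup₂ (f := fun f (_ : autocorr P π f 0 ≠ 0) => expTimeOf P π f) f hadm)
  refine le_limsup_of_frequently_le' (Eventually.frequently ?_)
  filter_upwards [eventually_gt_atTop 0] with t ht
  rw [hρ, abs_of_pos (pow_pos hμ t)]
  exact inv_ofReal_neg_log_le_div hc hcμ ht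

theorem exists_eigenvector_of_le_inner {E : Type*} [NormedAddCommGroup E] [InnerProductSpace ℝ E]
    [FiniteDimensional ℝ E] {T : E →ₗ[ℝ] E} (hT : T.IsSymmetric) {x : E} (hx : x ≠ 0)
    (hc : c * ‖x‖ ^ 2 ≤ inner ℝ (T x) x) : ∃ y ≠ 0, ∃ μ, c ≤ μ ∧ T y = μ • y := by
  have : Nontrivial E := ⟨x, 0, hx⟩
  have hbdd : BddAbove (Set.range fun y : {y : E // y ≠ 0} => inner ℝ (T y) y / ‖(y : E)‖ ^ 2) := by
    refine ⟨‖T.toContinuousLinearMap‖, ?_⟩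
    rintro _ ⟨y, rfl⟩
    exact (le_abs_self _).trans (T.toContinuousLinearMap.rayleighQuotient_le_norm y)
  obtain ⟨y, hy⟩ := hT.hasEigenvalue_iSup_of_finiteDimensional.exists_hasEigenvector
  exact ⟨y, hy.2, _,
    le_ciSup_of_le hbdd ⟨x, hx⟩ ((le_div_iff₀ (by positivity)).mpr hc), hy.apply_eq_smul⟩

theorem exists_eigenvector_mem_of_le_inner {V : Type*} [AddCommGroup V] [Module ℝ V]
    [FiniteDimensional ℝ V] (B : InnerProductSpace.Core ℝ V) {T : V →ₗ[ℝ] V}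
    (hT : ∀ x y, B.inner (T x) y = B.inner x (T y)) {K : Submodule ℝ V}
    (hK : ∀ x ∈ K, T x ∈ K) {x : V} (hxK : x ∈ K) (hx : x ≠ 0)
    (hc : c * B.inner x x ≤ B.inner (T x) x) : ∃ y ∈ K, y ≠ 0 ∧ ∃ μ, c ≤ μ ∧ T y = μ • y := by
  let : NormedAddCommGroup V := B.toNormedAddCommGroup
  let : InnerProductSpace ℝ V := InnerProductSpace.ofCore B.toCore
  have hT' : T.IsSymmetric := hT
  obtain ⟨y, hy, μ, hμ, hev⟩ := exists_eigenvector_of_le_inner (hT'.restrict_invariant hK)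
    (x := ⟨x, hxK⟩) (c := c) (fun h0 => hx (congrArg Subtype.val h0))
    (by rw [← real_inner_self_eq_norm_sq]; exact hc)
  exact ⟨y, y.2, fun h0 => hy (Subtype.ext h0), μ, hμ, congrArg Subtype.val hev⟩

namespace IsReversibleChain

theorem sum_mul_mulVec (h : IsReversibleChain P π) (f g : S → ℝ) :
    ∑ x, π x * (P.mulVec f x * g x) = ∑ x, π x * (f x * P.mulVec g x) := by
  simp only [Matrix.mulVec, dotProduct, Finset.sum_mul, Finset.mul_sum]
  rw [Finset.sum_comm]
  refine Finset.sum_congr rfl fun x _ => Finset.sum_congr rfl fun y _ => ?_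
  linear_combination f x * g y * h.reversible y x

theorem sum_mulVec (h : IsReversibleChain P π) (f : S → ℝ) :
    ∑ x, π x * P.mulVec f x = ∑ x, π x * f x := by
  have hone : P.mulVec 1 = 1 := by
    ext x
    simp [Matrix.mulVec, dotProduct, h.row_sum]
  simpa [hone] using h.sum_mul_mulVec f 1

/-- The inner product of `L²(π)`, for which the transition matrix of a reversible chain is
symmetric. -/
abbrev innerCore (h : IsReversibleChain P π) : InnerProductSpace.Core ℝ (S → ℝ) where
  inner f g := ∑ x, π x * (f x * g x)
  conj_inner_symm f g := by simp [mul_comm]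
  re_inner_nonneg f := Finset.sum_nonneg fun x _ => mul_nonneg (h.pos x).le (mul_self_nonneg _)
  add_left f g k := by
    rw [← Finset.sum_add_distrib]
    exact Finset.sum_congr rfl fun x _ => by rw [Pi.add_apply]; ring
  smul_left f g r := by
    rw [Finset.mul_sum]
    exact Finset.sum_congr rfl fun x _ => by rw [Pi.smul_apply, smul_eq_mul, conj_trivial]; ring
  definite f hf := by
    have hnonneg : ∀ x ∈ Finset.univ, 0 ≤ π x * (f x * f x) :=
      fun x _ => mul_nonneg (h.pos x).le (mul_self_nonneg _)
    ext x
    simpa [(h.pos x).ne'] using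
      (Finset.sum_eq_zero_iff_of_nonneg hnonneg).mp hf x (Finset.mem_univ x)

theorem exists_eigenvector_of_le (h : IsReversibleChain P π) {g : S → ℝ} (hg : g ≠ 0)
    (hmean : ∑ x, π x * g x = 0)
    (hc : c * ∑ x, π x * (g x * g x) ≤ ∑ x, π x * (P.mulVec g x * g x)) :
    ∃ f ≠ 0, ∃ μ, ∑ x, π x * f x = 0 ∧ P.mulVec f = μ • f ∧ c ≤ μ := by
  let K : Submodule ℝ (S → ℝ) := LinearMap.ker (Fintype.linearCombination ℝ π)
  have hK : ∀ f, f ∈ K ↔ ∑ x, π x * f x = 0 := fun f => by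
    simp [K, Fintype.linearCombination_apply, mul_comm]
  have hPK : ∀ f ∈ K, Matrix.toLin' P f ∈ K := fun f hf => by
    rwa [hK, Matrix.toLin'_apply, h.sum_mulVec, ← hK]
  obtain ⟨f, hfK, hf, μ, hμ, hev⟩ := exists_eigenvector_mem_of_le_inner h.innerCore
    (T := Matrix.toLin' P) h.sum_mul_mulVec hPK ((hK g).mpr hmean) hg hc
  exact ⟨f, hf, μ, (hK f).mp hfK, hev, hμ⟩

theorem sum_mul_mulVec_self (h : IsReversibleChain P π) (g : S → ℝ) :
    ∑ x, π x * (P.mulVec g x * g x) =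
      ∑ x, π x * (g x * g x) - (∑ x, ∑ y, π x * P x y * (g x - g y) ^ 2) / 2 := by
  have hleft : ∑ x, ∑ y, π x * P x y * (g x * g x) = ∑ x, π x * (g x * g x) :=
    Finset.sum_congr rfl fun x _ => by
      rw [← Finset.sum_mul, ← Finset.mul_sum, h.row_sum, mul_one]
  have hright : ∑ x, ∑ y, π x * P x y * (g y * g y) = ∑ x, π x * (g x * g x) := by
    rw [← hleft, Finset.sum_comm]
    exact Finset.sum_congr rfl fun x _ => Finset.sum_congr rfl fun y _ => by rw [h.reversible]
  have hcross : ∑ x, ∑ y, π x * P x y * (g y * g x) = ∑ x, π x * (P.mulVec g x * g x) := by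
    simp only [Matrix.mulVec, dotProduct, Finset.sum_mul, Finset.mul_sum]
    exact Finset.sum_congr rfl fun x _ => Finset.sum_congr rfl fun y _ => by ring
  have hexpand : ∑ x, ∑ y, π x * P x y * (g x - g y) ^ 2 =
      ∑ x, ∑ y, π x * P x y * (g x * g x) + ∑ x, ∑ y, π x * P x y * (g y * g y)
        - 2 * ∑ x, ∑ y, π x * P x y * (g y * g x) := by
    simp only [Finset.mul_sum, ← Finset.sum_add_distrib, ← Finset.sum_sub_distrib]
    exact Finset.sum_congr rfl fun x _ => Finset.sum_congr rfl fun y _ => by ring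
  rw [hexpand, hleft, hright, hcross]
  ring

end IsReversibleChain

/-- The stationary probability that the chain steps from `A` to its complement. -/
def flow (P : Matrix S S ℝ) (π : S → ℝ) (A : S → Prop) : ℝ :=
  ∑ x, ∑ y, if A x ∧ ¬ A y then π x * P x y else 0

/-- The total weight of the event `A`; it is its probability if `π` is normalized. -/
def eventWeight (π : S → ℝ) (A : S → Prop) : ℝ := ∑ x, if A x then π x else 0

theorem eventWeight_not (π : S → ℝ) (A : S → Prop) :
    eventWeight π (fun x => ¬ A x) = ∑ x, π x - eventWeight π A := by
  rw [eventWeight, eventWeight, ← Finset.sum_sub_distrib]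
  exact Finset.sum_congr rfl fun x _ => by by_cases hx : A x <;> simp [hx]

theorem eventWeight_nonneg (hf : ∀ x, 0 ≤ f x) (A : S → Prop) : 0 ≤ eventWeight f A :=
  Finset.sum_nonneg fun x _ => by split_ifs <;> simp [hf x]

theorem eventWeight_mono {g : S → ℝ} {A : S → Prop} (h : ∀ x, A x → f x ≤ g x) :
    eventWeight f A ≤ eventWeight g A :=
  Finset.sum_le_sum fun x _ => by split_ifs with hx <;> simp [h x, hx]

theorem eventWeight_const_mul (c : ℝ) (f : S → ℝ) (A : S → Prop) :
    eventWeight (fun x => c * f x) A = c * eventWeight f A := by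
  simp only [eventWeight, Finset.mul_sum, mul_ite, mul_zero]

theorem eventWeight_div_const (f : S → ℝ) (c : ℝ) (A : S → Prop) :
    eventWeight (fun x => f x / c) A = eventWeight f A / c := by
  simp only [div_eq_inv_mul, eventWeight_const_mul]

theorem eventWeight_le_of_perm (hf : ∀ x, 0 ≤ f x) (φ : Equiv.Perm S) (hφ : ∀ x, f (φ x) = f x)
    {A B : S → Prop} (hAB : ∀ x, f x ≠ 0 → A x → B (φ x)) :
    eventWeight f A ≤ eventWeight f B := by
  rw [eventWeight, eventWeight, ← Equiv.sum_comp φ fun x => if B x then f x else 0]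
  refine Finset.sum_le_sum fun x _ => ?_
  rw [hφ]
  by_cases hx : f x = 0
  · simp [hx]
  · split_ifs with hA hB
    exacts [le_rfl, absurd (hAB x hx hA) hB, hf x, le_rfl]

/-- Both relaxation quantities of the chain are at least what an eigenvalue `1 - η` forces. -/
structure IsSlow (P : Matrix S S ℝ) (π : S → ℝ) (η : ℝ) : Prop where
  le_secondSpectralRadius : 1 - η ≤ secondSpectralRadius P
  le_expTime : (ENNReal.ofReal (-Real.log (1 - η)))⁻¹ ≤ expTime P π

namespace IsReversibleChain

theorem sum_sq_indicator_sub (h : IsReversibleChain P π) (A : S → Prop) (a : ℝ) :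
    ∑ x, ∑ y, π x * P x y * (((if A x then 1 else 0) - a) - ((if A y then 1 else 0) - a)) ^ 2 =
      2 * flow P π A := by
  have hrev : ∑ x, ∑ y, (if A y ∧ ¬ A x then π x * P x y else 0) = flow P π A := by
    rw [flow, Finset.sum_comm]
    exact Finset.sum_congr rfl fun x _ => Finset.sum_congr rfl fun y _ => by rw [h.reversible]
  rw [two_mul]
  nth_rewrite 2 [← hrev]
  rw [flow, ← Finset.sum_add_distrib]
  refine Finset.sum_congr rfl fun x _ => ?_
  rw [← Finset.sum_add_distrib]
  refine Finset.sum_congr rfl fun y _ => ?_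
  by_cases hx : A x <;> by_cases hy : A y <;> simp [hx, hy]
  ring

theorem bottleneck (h : IsReversibleChain P π) (A : S → Prop) {η : ℝ} (hη : η < 1)
    (hA : 0 < eventWeight π A) (hA' : 0 < eventWeight π fun x => ¬ A x)
    (hflow : flow P π A ≤ η * (eventWeight π A * eventWeight π fun x => ¬ A x)) :
    IsSlow P π η := by
  rw [eventWeight_not, h.sum_eq_one] at hA' hflow
  set a := eventWeight π A with ha
  set g : S → ℝ := fun x => (if A x then 1 else 0) - a with hg
  have hmass : ∑ x, π x * (if A x then 1 else 0) = a := by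
    simp only [mul_ite, mul_one, mul_zero, ha, eventWeight]
  have hmean : ∑ x, π x * g x = 0 := by
    simp only [hg, mul_sub, Finset.sum_sub_distrib, hmass, ← Finset.sum_mul, h.sum_eq_one, one_mul,
      sub_self]
  have hvar : ∑ x, π x * (g x * g x) = a * (1 - a) := by
    have : ∀ x, π x * (g x * g x) =
        (1 - a) * (π x * (if A x then 1 else 0)) - a * (π x * g x) := fun x => by
      by_cases hx : A x <;> simp only [hg, hx, if_true, if_false] <;> ring
    simp only [this, Finset.sum_sub_distrib, ← Finset.mul_sum, hmass, hmean]
    ring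
  have hg0 : g ≠ 0 := by
    intro h0
    simp only [h0, Pi.zero_apply, mul_zero, Finset.sum_const_zero] at hvar
    exact (mul_pos hA hA').ne hvar
  obtain ⟨f, hf, μ, hfmean, hev, hμ⟩ := h.exists_eigenvector_of_le (c := 1 - η) hg0 hmean (by
    rw [h.sum_mul_mulVec_self, h.sum_sq_indicator_sub, hvar]
    linarith)
  exact ⟨hμ.trans ((le_abs_self μ).trans (h.abs_le_secondSpectralRadius hf hfmean hev)),
    h.le_expTime hf hfmean hev (by linarith) hμ⟩

end IsReversibleChain

end ReversibleChains

/-! ### The Edwards–Sokal coupling -/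

section EdwardsSokal

section Edges

variable {V : Type*} {σ σ' : Spins V} {x y : V}

theorem edgeSpin_mk (σ : Spins V) (x y : V) :
    edgeSpin σ s(x, y) = ((σ x * σ y : ℤˣ) : ℤ) := rfl

theorem edgeSpin_eq_one_or (σ : Spins V) (e : Sym2 V) :
    edgeSpin σ e = 1 ∨ edgeSpin σ e = -1 := by
  rcases Int.units_eq_one_or ((e.map σ).mul : ℤˣ) with h | h <;> simp [edgeSpin, h]

theorem abs_edgeSpin (σ : Spins V) (e : Sym2 V) : |edgeSpin σ e| = 1 := by
  rcases edgeSpin_eq_one_or σ e with h | h <;> simp [h]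

theorem edgeSpin_mk_inj (h : edgeSpin σ s(x, y) = edgeSpin σ' s(x, y)) :
    σ x * σ y = σ' x * σ' y := by
  rw [edgeSpin_mk, edgeSpin_mk] at h
  exact Units.ext (by exact_mod_cast h)

theorem edgeSpin_eq_one_iff : edgeSpin σ s(x, y) = 1 ↔ σ x = σ y := by
  rw [edgeSpin_mk, Int.cast_eq_one, Units.val_eq_one, mul_eq_one_iff_eq_inv, Int.units_inv_eq_self]

theorem reachable_closed {H : SimpleGraph V} {p : V → Prop}
    (hp : ∀ a b, H.Adj a b → p a → p b) (h : H.Reachable x y) (hx : p x) : p y := by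
  obtain ⟨w⟩ := h
  induction w with
  | nil => exact hx
  | cons hab _ ih => exact ih (hp _ _ hab hx)

end Edges

section Bonds

variable {V : Type*} (G : SimpleGraph V) (J : G.edgeSet → ℝ) (β : ℝ)

/-- The unnormalized Edwards–Sokal weight of a single edge in the state `b`. -/
def edgeWeight (σ : Spins V) (e : G.edgeSet) (b : Bool) : ℝ :=
  if b = true then
    (if 0 ≤ J e * edgeSpin σ e then Real.exp (β * |J e|) - Real.exp (-(β * |J e|)) else 0)
  else Real.exp (-(β * |J e|))

/-- The spins obey the rule `J_e σ_x σ_y ≥ 0` on every open edge. -/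
def Consistent (σ : Spins V) (η : G.edgeSet → Bool) : Prop :=
  ∀ e : G.edgeSet, η e = true → 0 ≤ J e * edgeSpin σ e

variable {G J β} {σ σ' : Spins V} {e : G.edgeSet} {η : G.edgeSet → Bool} {x y : V}

theorem coupling_mul_spin (h : 0 ≤ J e * edgeSpin σ e) : J e * edgeSpin σ e = |J e| := by
  rw [← abs_of_nonneg h, abs_mul, abs_edgeSpin, mul_one]

theorem coupling_mul_spin_neg (h : ¬ 0 ≤ J e * edgeSpin σ e) :
    J e * edgeSpin σ e = -|J e| := by
  have habs := abs_of_neg (not_le.mp h)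
  rw [abs_mul, abs_edgeSpin, mul_one] at habs
  linarith

theorem edgeSpin_eq_one_of_pos (he : 0 < J e) (h : 0 ≤ J e * edgeSpin σ e) :
    edgeSpin σ e = 1 := by
  refine (edgeSpin_eq_one_or σ e).resolve_right fun hneg => ?_
  rw [hneg] at h
  linarith

theorem edgeWeight_nonneg (hβ : 0 ≤ β) (σ : Spins V) (e : G.edgeSet) (b : Bool) :
    0 ≤ edgeWeight G J β σ e b := by
  have h : 0 ≤ β * |J e| := mul_nonneg hβ (abs_nonneg _)
  have hexp : Real.exp (-(β * |J e|)) ≤ Real.exp (β * |J e|) :=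
    Real.exp_le_exp.mpr (by linarith)
  unfold edgeWeight
  split_ifs
  · linarith
  · exact le_rfl
  · exact (Real.exp_pos _).le

theorem edgeWeight_sum (σ : Spins V) (e : G.edgeSet) :
    ∑ b, edgeWeight G J β σ e b = Real.exp (β * (J e * edgeSpin σ e)) := by
  simp only [Fintype.sum_bool, edgeWeight, if_true, Bool.false_eq_true, if_false]
  split_ifs with h
  · rw [coupling_mul_spin h]
    ring
  · rw [coupling_mul_spin_neg h]
    simp

theorem openGraph_adj :
    (openGraph G η).Adj x y ↔ ∃ h : s(x, y) ∈ G.edgeSet, η ⟨s(x, y), h⟩ = true := by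
  rw [openGraph, SimpleGraph.fromEdgeSet_adj]
  exact ⟨fun h => h.1, fun h => ⟨h, G.ne_of_adj h.1⟩⟩

theorem Consistent.mul_eq_mul_of_adj (hσ : Consistent G J σ η) (hσ' : Consistent G J σ' η)
    (hJ : ∀ e, η e = true → J e ≠ 0) (h : (openGraph G η).Adj x y) :
    σ x * σ' x = σ y * σ' y := by
  obtain ⟨he, hη⟩ := openGraph_adj.mp h
  have hedge : σ x * σ y = σ' x * σ' y := edgeSpin_mk_inj <| mul_left_cancel₀ (hJ _ hη) <|
    (coupling_mul_spin (hσ _ hη)).trans (coupling_mul_spin (hσ' _ hη)).symm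
  calc σ x * σ' x = σ x * σ y * (σ y * σ' x) := by
        rw [mul_assoc, ← mul_assoc (σ y), Int.units_mul_self, one_mul]
    _ = σ y * σ' y * (σ' x * σ' x) := by
        rw [hedge]
        ac_rfl
    _ = σ y * σ' y := by rw [Int.units_mul_self, mul_one]

theorem Consistent.mul_clusterSign (hσ : Consistent G J σ η)
    (τ : (openGraph G η).ConnectedComponent → ℤˣ) :
    Consistent G J (fun x => σ x * τ ((openGraph G η).connectedComponentMk x)) η := by
  rintro ⟨e, he⟩ hη
  induction e with
  | _ x y =>
    have hcluster : (openGraph G η).connectedComponentMk x =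
        (openGraph G η).connectedComponentMk y :=
      SimpleGraph.ConnectedComponent.eq.mpr (openGraph_adj.mpr ⟨he, hη⟩).reachable
    have hspin : edgeSpin (fun x => σ x * τ ((openGraph G η).connectedComponentMk x)) s(x, y)
        = edgeSpin σ s(x, y) := by
      rw [edgeSpin_mk, edgeSpin_mk, hcluster, mul_mul_mul_comm, Int.units_mul_self, mul_one]
    simpa only [hspin] using hσ ⟨s(x, y), he⟩ hη

/-- The spin configurations obtained from a consistent one by flipping clusters. -/
def clusterFlip (hσ : Consistent G J σ η) (τ : (openGraph G η).ConnectedComponent → ℤˣ) :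
    {σ' : Spins V // Consistent G J σ' η} :=
  ⟨fun x => σ x * τ ((openGraph G η).connectedComponentMk x), hσ.mul_clusterSign τ⟩

theorem clusterFlip_injective (hσ : Consistent G J σ η) :
    Function.Injective (clusterFlip hσ) := by
  intro τ τ' h
  funext c
  induction c using SimpleGraph.ConnectedComponent.ind with
  | _ x => exact mul_left_cancel (congrFun (Subtype.ext_iff.mp h) x)

theorem clusterFlip_surjective (hσ : Consistent G J σ η) (hJ : ∀ e, η e = true → J e ≠ 0) :
    Function.Surjective (clusterFlip hσ) := by
  rintro ⟨σ', hσ'⟩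
  refine ⟨SimpleGraph.ConnectedComponent.lift (fun x => σ x * σ' x) fun x y p _ =>
    reachable_closed (p := fun z => σ x * σ' x = σ z * σ' z)
      (fun _ _ hab hxa => hxa.trans (hσ.mul_eq_mul_of_adj hσ' hJ hab)) p.reachable rfl,
    Subtype.ext (funext fun x => ?_)⟩
  simp only [clusterFlip, SimpleGraph.ConnectedComponent.lift_mk, ← mul_assoc,
    Int.units_mul_self, one_mul]

theorem card_consistent [Finite V] (hσ : Consistent G J σ η) (hJ : ∀ e, η e = true → J e ≠ 0) :
    Nat.card {σ' : Spins V // Consistent G J σ' η}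
      = 2 ^ Nat.card (openGraph G η).ConnectedComponent := by
  rw [← Nat.card_eq_of_bijective _ ⟨clusterFlip_injective hσ, clusterFlip_surjective hσ hJ⟩,
    Nat.card_fun]
  simp

end Bonds

variable {V : Type*} [Fintype V] (G : SimpleGraph V) (J : G.edgeSet → ℝ) (β : ℝ)

/-- The unnormalized Gibbs weight. -/
def boltzmann (σ : Spins V) : ℝ := Real.exp (-β * hamiltonian G J σ)

/-- The unnormalized Edwards–Sokal weight, a joint law of spins and bonds whose marginal on the
spins is the Gibbs measure. -/
def jointWeight (σ : Spins V) (η : G.edgeSet → Bool) : ℝ := ∏ e, edgeWeight G J β σ e (η e)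

/-- The random cluster weight without the cluster counting factor. -/
def bondWeight (η : G.edgeSet → Bool) : ℝ :=
  ∏ e, if η e = true then Real.exp (β * |J e|) - Real.exp (-(β * |J e|))
    else Real.exp (-(β * |J e|))

variable {G J β}

theorem boltzmann_eq_prod (σ : Spins V) :
    boltzmann G J β σ = ∏ e, Real.exp (β * (J e * edgeSpin σ e)) := by
  rw [boltzmann, hamiltonian, ← Real.exp_sum, ← Finset.mul_sum]
  congr 1
  ring

theorem boltzmann_pos (σ : Spins V) : 0 < boltzmann G J β σ := Real.exp_pos _

theorem sum_boltzmann_pos : 0 < ∑ ω, boltzmann G J β ω :=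
  Finset.sum_pos (fun ω _ => boltzmann_pos ω) Finset.univ_nonempty

theorem spinStep_eq (η : G.edgeSet → Bool) (σ : Spins V) :
    spinStep G J η σ = if Consistent G J σ η then
      (1 / 2 : ℝ) ^ Nat.card (openGraph G η).ConnectedComponent else 0 := by
  unfold spinStep Consistent
  congr

theorem spinStep_nonneg (η : G.edgeSet → Bool) (σ : Spins V) : 0 ≤ spinStep G J η σ := by
  unfold spinStep
  split_ifs <;> positivity

theorem gibbs_eq (σ : Spins V) :
    gibbs G J β σ = boltzmann G J β σ / ∑ ω, boltzmann G J β ω := rfl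

theorem jointWeight_nonneg (hβ : 0 ≤ β) (σ : Spins V) (η : G.edgeSet → Bool) :
    0 ≤ jointWeight G J β σ η := Finset.prod_nonneg fun e _ => edgeWeight_nonneg hβ σ e _

theorem jointWeight_sum (σ : Spins V) :
    ∑ η, jointWeight G J β σ η = boltzmann G J β σ := by
  rw [boltzmann_eq_prod]
  simp only [← edgeWeight_sum, jointWeight]
  rw [Finset.prod_univ_sum, Fintype.piFinset_univ]

theorem jointWeight_eq (σ : Spins V) (η : G.edgeSet → Bool) :
    jointWeight G J β σ η = if Consistent G J σ η then bondWeight G J β η else 0 := by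
  split_ifs with h
  · refine Finset.prod_congr rfl fun e _ => ?_
    unfold edgeWeight
    by_cases hb : η e = true
    · simp [hb, h e hb]
    · simp [hb]
  · unfold Consistent at h
    push Not at h
    obtain ⟨e, he, hlt⟩ := h
    exact Finset.prod_eq_zero (Finset.mem_univ e) (by simp [edgeWeight, he, hlt.not_ge])

theorem boltzmann_mul_bondStep (σ : Spins V) (η : G.edgeSet → Bool) :
    boltzmann G J β σ * bondStep G J β σ η = jointWeight G J β σ η := by
  rw [boltzmann_eq_prod, bondStep, ← Finset.prod_mul_distrib]
  refine Finset.prod_congr rfl fun e _ => ?_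
  unfold edgeWeight bondProb
  by_cases h : 0 ≤ J e * edgeSpin σ e
  · have hexp : Real.exp (β * |J e|) * Real.exp (-2 * β * |J e|) = Real.exp (-(β * |J e|)) := by
      rw [← Real.exp_add]
      congr 1
      ring
    rw [if_pos h, if_pos h, coupling_mul_spin h]
    split_ifs
    · rw [mul_sub, hexp, mul_one]
    · rw [sub_sub_cancel, hexp]
  · rw [if_neg h, if_neg h, coupling_mul_spin_neg h]
    split_ifs <;> simp

theorem bondStep_nonneg (hβ : 0 ≤ β) (σ : Spins V) (η : G.edgeSet → Bool) :
    0 ≤ bondStep G J β σ η := by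
  have h := jointWeight_nonneg (G := G) (J := J) hβ σ η
  rw [← boltzmann_mul_bondStep] at h
  exact nonneg_of_mul_nonneg_right h (boltzmann_pos σ)

theorem bondStep_sum (σ : Spins V) : ∑ η, bondStep G J β σ η = 1 := by
  have h := jointWeight_sum (G := G) (J := J) (β := β) σ
  simp only [← boltzmann_mul_bondStep] at h
  rw [← Finset.mul_sum] at h
  exact mul_left_cancel₀ (boltzmann_pos σ).ne' (by rw [h, mul_one])

theorem coupling_ne_zero {η : G.edgeSet → Bool} (h : bondWeight G J β η ≠ 0) (e : G.edgeSet)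
    (he : η e = true) : J e ≠ 0 := fun h0 =>
  Finset.prod_ne_zero_iff.mp h e (Finset.mem_univ e) (by simp [he, h0])

theorem spinStep_sum {σ : Spins V} {η : G.edgeSet → Bool} (h : jointWeight G J β σ η ≠ 0) :
    ∑ σ', spinStep G J η σ' = 1 := by
  rw [jointWeight_eq, ite_ne_right_iff] at h
  have hcard : (Finset.univ.filter fun σ' => Consistent G J σ' η).card
      = 2 ^ Nat.card (openGraph G η).ConnectedComponent := by
    rw [← card_consistent h.1 (coupling_ne_zero h.2), Nat.card_eq_fintype_card,
      Fintype.card_subtype]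
  simp only [spinStep_eq]
  rw [← Finset.sum_filter, Finset.sum_const, nsmul_eq_mul, hcard, Nat.cast_pow, Nat.cast_ofNat,
    ← mul_pow, mul_one_div_cancel two_ne_zero, one_pow]

theorem isReversibleChain_swMatrix (hβ : 0 ≤ β) :
    IsReversibleChain (swMatrix G J β) (gibbs G J β) where
  pos σ := div_pos (boltzmann_pos σ) sum_boltzmann_pos
  sum_eq_one := by
    simp only [gibbs_eq]
    rw [← Finset.sum_div, div_self sum_boltzmann_pos.ne']
  nonneg σ σ' := Finset.sum_nonneg fun η _ =>
    mul_nonneg (bondStep_nonneg hβ σ η) (spinStep_nonneg η σ')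
  row_sum σ := by
    simp only [swMatrix]
    rw [Finset.sum_comm, ← bondStep_sum (G := G) (J := J) (β := β) σ]
    refine Finset.sum_congr rfl fun η _ => ?_
    rw [← Finset.mul_sum]
    by_cases h : jointWeight G J β σ η = 0
    · rw [← boltzmann_mul_bondStep] at h
      rw [(mul_eq_zero.mp h).resolve_left (boltzmann_pos σ).ne', zero_mul]
    · rw [spinStep_sum h, mul_one]
  reversible σ σ' := by
    rw [gibbs_eq, gibbs_eq, div_mul_eq_mul_div, div_mul_eq_mul_div]
    congr 1
    simp only [swMatrix, Finset.mul_sum, ← mul_assoc, boltzmann_mul_bondStep]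
    refine Finset.sum_congr rfl fun η _ => ?_
    rw [jointWeight_eq, jointWeight_eq, spinStep_eq, spinStep_eq]
    split_ifs <;> simp

theorem sum_jointWeight_mul_spinStep_le (hβ : 0 ≤ β) (B : Spins V → Prop) [DecidablePred B]
    (σ : Spins V) (η : G.edgeSet → Bool) :
    (∑ σ', if B σ' then jointWeight G J β σ η * spinStep G J η σ' else 0) ≤
      if ∃ σ', B σ' ∧ Consistent G J σ' η then jointWeight G J β σ η else 0 := by
  split_ifs with h
  · by_cases h0 : jointWeight G J β σ η = 0
    · simp [h0]
    calc _ ≤ ∑ σ', jointWeight G J β σ η * spinStep G J η σ' := by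
          refine Finset.sum_le_sum fun σ' _ => ?_
          split_ifs
          · exact le_rfl
          · exact mul_nonneg (jointWeight_nonneg hβ σ η) (spinStep_nonneg η σ')
      _ = _ := by rw [← Finset.mul_sum, spinStep_sum h0, mul_one]
  · refine (Finset.sum_eq_zero fun σ' _ => ?_).le
    split_ifs with hB
    · rw [spinStep_eq, if_neg fun hc => h ⟨σ', hB, hc⟩, mul_zero]
    · rfl

theorem flow_swMatrix_le (hβ : 0 ≤ β) (A : Spins V → Prop) :
    flow (swMatrix G J β) (gibbs G J β) A * ∑ ω, boltzmann G J β ω ≤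
      ∑ σ, ∑ η, if A σ ∧ ∃ σ', ¬ A σ' ∧ Consistent G J σ' η then jointWeight G J β σ η else 0 := by
  rw [flow, Finset.sum_mul]
  refine Finset.sum_le_sum fun σ _ => ?_
  rw [Finset.sum_mul]
  have hstep : ∀ σ', (if A σ ∧ ¬ A σ' then gibbs G J β σ * swMatrix G J β σ σ' else 0)
      * ∑ ω, boltzmann G J β ω = ∑ η, if A σ ∧ ¬ A σ' then
        jointWeight G J β σ η * spinStep G J η σ' else 0 := by
    intro σ'
    split_ifs with h
    · rw [gibbs_eq, div_mul_eq_mul_div, div_mul_cancel₀ _ sum_boltzmann_pos.ne', swMatrix,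
        Finset.mul_sum]
      exact Finset.sum_congr rfl fun η _ => by rw [← mul_assoc, boltzmann_mul_bondStep]
    · simp
  simp only [hstep]
  rw [Finset.sum_comm]
  refine Finset.sum_le_sum fun η _ => ?_
  by_cases hA : A σ
  · simpa only [hA, true_and] using sum_jointWeight_mul_spinStep_le hβ (fun σ' => ¬ A σ') σ η
  · simp [hA]

end EdwardsSokal

/-! ### Peierls' argument -/

section FiniteEnergy

variable {E : Type*} [DecidableEq E] {T : Finset E} {Y : Finset E → ℝ} {r : ℝ}

theorem sum_powerset_sdiff_le (hr : 0 ≤ r)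
    (hY : ∀ τ ⊆ T, ∀ e ∈ T, e ∉ τ → r * Y τ ≤ Y (insert e τ))
    (W : Finset E) (hW : W ⊆ T) :
    (1 + r) ^ W.card * ∑ τ ∈ (T \ W).powerset, Y τ ≤ ∑ τ ∈ T.powerset, Y τ := by
  induction W using Finset.induction_on with
  | empty => simp
  | insert e W he ih =>
    have heT : e ∈ T := hW (Finset.mem_insert_self e W)
    refine le_trans ?_ (ih ((Finset.subset_insert e W).trans hW))
    rw [Finset.card_insert_of_notMem he, pow_succ, mul_assoc]
    refine mul_le_mul_of_nonneg_left ?_ (by positivity)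
    have hnot : e ∉ T \ insert e W := by simp
    have hsplit : insert e (T \ insert e W) = T \ W := by
      rw [Finset.sdiff_insert, Finset.insert_erase (Finset.mem_sdiff.mpr ⟨heT, he⟩)]
    rw [← hsplit, Finset.sum_powerset_insert hnot, add_mul, one_mul, Finset.mul_sum]
    refine add_le_add_right (Finset.sum_le_sum fun τ hτ => ?_) _
    rw [Finset.mem_powerset] at hτ
    exact hY τ (hτ.trans Finset.sdiff_subset) e heT fun h => hnot (hτ h)

theorem sum_not_good_le (hr : 0 ≤ r) (hY0 : ∀ τ, 0 ≤ Y τ)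
    (hY : ∀ τ ⊆ T, ∀ e ∈ T, e ∉ τ → r * Y τ ≤ Y (insert e τ))
    (F : Finset (Finset E)) (hF : ∀ W ∈ F, W ⊆ T) (Good : Finset E → Prop) [DecidablePred Good]
    (hGood : ∀ τ ⊆ T, (∀ W ∈ F, ∃ e ∈ W, e ∈ τ) → Good τ) :
    ∑ τ ∈ T.powerset, (if Good τ then 0 else Y τ) ≤
      (∑ W ∈ F, ((1 + r)⁻¹) ^ W.card) * ∑ τ ∈ T.powerset, Y τ := by
  have hunion : ∀ τ ∈ T.powerset, (if Good τ then 0 else Y τ) ≤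
      ∑ W ∈ F, if τ ⊆ T \ W then Y τ else 0 := by
    intro τ hτ
    have hterm : ∀ W ∈ F, 0 ≤ if τ ⊆ T \ W then Y τ else 0 := fun W _ => by
      split_ifs
      · exact hY0 τ
      · exact le_rfl
    split_ifs with hg
    · exact Finset.sum_nonneg hterm
    · rw [Finset.mem_powerset] at hτ
      obtain ⟨W, hW, hWτ⟩ : ∃ W ∈ F, ∀ e ∈ W, e ∉ τ := by
        by_contra! hopen
        exact hg (hGood τ hτ hopen)
      refine le_trans ?_ (Finset.single_le_sum hterm hW)
      rw [if_pos (Finset.subset_sdiff.mpr ⟨hτ, Finset.disjoint_left.mpr fun e he h => hWτ e h he⟩)]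
  refine (Finset.sum_le_sum hunion).trans ?_
  rw [Finset.sum_comm, Finset.sum_mul]
  refine Finset.sum_le_sum fun W hW => ?_
  have hclosed : T.powerset.filter (· ⊆ T \ W) = (T \ W).powerset := by
    ext τ
    simp only [Finset.mem_filter, Finset.mem_powerset]
    exact ⟨fun h => h.2, fun h => ⟨h.trans Finset.sdiff_subset, h⟩⟩
  rw [← Finset.sum_filter, hclosed, inv_pow, inv_mul_eq_div, le_div_iff₀ (by positivity), mul_comm]
  exact sum_powerset_sdiff_le hr hY W (hF W hW)

end FiniteEnergy

section Flips

variable {V : Type*} {G : SimpleGraph V}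

/-- Reverse the spins in `C`. -/
def flipOn (C : Set V) (σ : Spins V) : Spins V := fun x => if x ∈ C then -σ x else σ x

theorem flipOn_involutive (C : Set V) : Function.Involutive (flipOn C) := by
  intro σ
  funext x
  unfold flipOn
  split_ifs <;> simp

theorem edgeSpin_flipOn {C : Set V} (σ : Spins V) {e : Sym2 V}
    (he : ∀ x ∈ e, ∀ y ∈ e, x ∈ C → y ∈ C) : edgeSpin (flipOn C σ) e = edgeSpin σ e := by
  induction e with
  | _ x y =>
    have hxy : x ∈ C ↔ y ∈ C := ⟨he x (by simp) y (by simp), he y (by simp) x (by simp)⟩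
    rw [edgeSpin_mk, edgeSpin_mk]
    by_cases hy : y ∈ C <;> simp [flipOn, hxy, hy]

theorem edgeSpin_flipOn_of_cut {C : Set V} (σ : Spins V) {x y : V}
    (hx : x ∈ C) (hy : y ∉ C) : edgeSpin (flipOn C σ) s(x, y) = -edgeSpin σ s(x, y) := by
  simp [edgeSpin_mk, flipOn, hx, hy]

/-- The vertices connected to `x` by edges of `τ`. -/
def cluster (τ : Finset G.edgeSet) (x : V) : Set V :=
  {z | (openGraph G fun e => decide (e ∈ τ)).Reachable x z}

theorem self_mem_cluster (τ : Finset G.edgeSet) (x : V) : x ∈ cluster τ x :=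
  SimpleGraph.Reachable.refl x

theorem cluster_closed {τ : Finset G.edgeSet} {x : V} {e : G.edgeSet} (he : e ∈ τ) :
    ∀ a ∈ (e : Sym2 V), ∀ b ∈ (e : Sym2 V), a ∈ cluster τ x → b ∈ cluster τ x := by
  intro a ha b hb hxa
  obtain rfl | hab := eq_or_ne a b
  · exact hxa
  obtain ⟨e, he'⟩ := e
  obtain rfl : e = s(a, b) := (Sym2.mem_and_mem_iff hab).mp ⟨ha, hb⟩
  exact SimpleGraph.Reachable.trans hxa
    (openGraph_adj.mpr ⟨he', decide_eq_true he⟩).reachable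

theorem cluster_induction {τ : Finset G.edgeSet} {x z : V} {p : V → Prop}
    (hp : ∀ a b (h : s(a, b) ∈ G.edgeSet), ⟨s(a, b), h⟩ ∈ τ → p a → p b)
    (hz : z ∈ cluster τ x) (hx : p x) : p z := by
  refine reachable_closed (fun a b hab => ?_) hz hx
  obtain ⟨h, hτ⟩ := openGraph_adj.mp hab
  exact hp a b h (of_decide_eq_true hτ)

theorem spin_eq_of_mem_cluster {τ : Finset G.edgeSet} {σ : Spins V}
    (hσ : ∀ e ∈ τ, edgeSpin σ e = 1) {x z : V} (hz : z ∈ cluster τ x) : σ x = σ z :=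
  cluster_induction (p := fun z => σ x = σ z)
    (fun _ _ _ he ha => ha.trans (edgeSpin_eq_one_iff.mp (hσ _ he))) hz rfl

end Flips

/-! ### Frustrated double blocks in a finite graph -/

section Gadget

variable {V : Type*} (G : SimpleGraph V) (J : G.edgeSet → ℝ) (β : ℝ)

/-- A frustrated double block: two strongly ferromagnetic regions, the second being `block`, joined
by `N` edges whose couplings are close to `± h / β` with as many positive as negative signs,
and almost disconnected from the remaining vertices by weak edges. -/
structure Gadget (N : ℕ) (h r : ℝ) where
  strong : Finset G.edgeSet
  weak : Finset G.edgeSet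
  link : Fin N → G.edgeSet
  left : Fin N → V
  right : Fin N → V
  sign : Fin N → ℝ
  core : Set V
  block : Set V
  link_injective : Function.Injective link
  link_eq : ∀ i, (link i : Sym2 V) = s(left i, right i)
  disjoint_weak : ∀ e ∈ strong, e ∉ weak
  link_notMem_strong : ∀ i, link i ∉ strong
  link_notMem_weak : ∀ i, link i ∉ weak
  strong_core : ∀ e ∈ strong, ∀ x ∈ (e : Sym2 V), x ∈ core
  strong_block : ∀ e ∈ strong, ∀ x ∈ (e : Sym2 V), ∀ y ∈ (e : Sym2 V), x ∈ block → y ∈ block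
  strong_pos : ∀ e ∈ strong, 0 < J e
  strong_large : ∀ e ∈ strong, 2 * r ≤ Real.exp (2 * (β * J e)) - 1
  other_core : ∀ e, e ∉ strong → e ∉ weak → (∀ i, e ≠ link i) → ∀ x ∈ (e : Sym2 V), x ∉ core
  block_core : block ⊆ core
  left_notMem : ∀ i, left i ∉ block
  right_mem : ∀ i, right i ∈ block
  sign_eq : ∀ i, sign i = 1 ∨ sign i = -1
  sign_sum : ∑ i, sign i = 0
  link_coupling : ∀ i, |β * J (link i) - sign i * h| ≤ h / 100
  weak_small : ∑ e ∈ weak, β * |J e| ≤ 1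

variable {G J β} {N : ℕ} {h r : ℝ} (D : Gadget G J β N h r)

theorem cast_spin_eq_one_or (u : ℤˣ) : ((u : ℤ) : ℝ) = 1 ∨ ((u : ℤ) : ℝ) = -1 := by
  rcases Int.units_eq_one_or u with h | h <;> simp [h]

theorem majority_mul_pos {a : Fin N → ℝ} (ha : ∀ i, a i = 1 ∨ a i = -1) {I : Finset (Fin N)}
    (hI : 7 * N ≤ 8 * I.card) (hN : 0 < N) {c : ℝ} (hc : c = 1 ∨ c = -1)
    (hac : ∀ i ∈ I, a i = c) : 0 < c * ∑ i, a i := by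
  have hterm : ∀ i, (if i ∈ I then (2 : ℝ) else 0) - 1 ≤ c * a i := by
    intro i
    split_ifs with hi
    · rw [hac i hi]
      rcases hc with rfl | rfl <;> norm_num
    · rcases hc with rfl | rfl <;> rcases ha i with h | h <;> rw [h] <;> norm_num
  rw [Finset.mul_sum]
  refine lt_of_lt_of_le ?_ (Finset.sum_le_sum fun i _ => hterm i)
  rw [Finset.sum_sub_distrib, Finset.sum_ite_mem, Finset.univ_inter, Finset.sum_const,
    Finset.sum_const, nsmul_eq_mul, nsmul_eq_mul, Finset.card_univ, Fintype.card_fin]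
  have hI' : (7 : ℝ) * N ≤ 8 * I.card := by exact_mod_cast hI
  have hN' : (0 : ℝ) < N := by exact_mod_cast hN
  linarith

namespace Gadget

/-- The edges of `τ`, when open, force a common spin on most of the left link ends, labelled by `I`,
and a common spin on the corresponding right link ends. -/
def IsPinned (τ : Finset G.edgeSet) (I : Finset (Fin N)) : Prop :=
  7 * N ≤ 8 * I.card ∧ ∀ σ : Spins V, (∀ e ∈ τ, edgeSpin σ e = 1) →
    (∀ i ∈ I, ∀ j ∈ I, σ (D.left i) = σ (D.left j)) ∧
    (∀ i ∈ I, ∀ j ∈ I, σ (D.right i) = σ (D.right j))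

/-- A choice of links pinned by `τ`, empty if there is none. -/
def pinnedLinks (τ : Finset G.edgeSet) : Finset (Fin N) :=
  if h : ∃ I, D.IsPinned τ I then h.choose else ∅

/-- The two regions are aligned, judged by the majorities of the link ends. -/
def Aligned (σ : Spins V) : Prop :=
  0 < (∑ i, ((σ (D.left i) : ℤ) : ℝ)) * ∑ i, ((σ (D.right i) : ℤ) : ℝ)

/-- The links as a set of edges. -/
def links : Finset G.edgeSet := Finset.univ.image D.link

/-- The open strong edges of a bond configuration. -/
def openStrong (η : G.edgeSet → Bool) : Finset G.edgeSet := D.strong.filter fun e => η e = true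

variable {D} {τ : Finset G.edgeSet} {I : Finset (Fin N)} {σ σ' : Spins V} {η : G.edgeSet → Bool}

theorem isPinned_pinnedLinks (h : ∃ I, D.IsPinned τ I) : D.IsPinned τ (D.pinnedLinks τ) := by
  rw [pinnedLinks, dif_pos h]
  exact h.choose_spec

theorem exists_isPinned_of_mem_pinnedLinks {i : Fin N} (hi : i ∈ D.pinnedLinks τ) :
    ∃ I, D.IsPinned τ I := by
  by_contra h
  simp [pinnedLinks, h] at hi

theorem IsPinned.nonempty (hI : D.IsPinned τ I) (hN : 0 < N) : I.Nonempty := by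
  have := hI.1
  rw [← Finset.card_pos]
  omega

theorem IsPinned.aligned_iff (hI : D.IsPinned τ I) (hN : 0 < N)
    (hσ : ∀ e ∈ τ, edgeSpin σ e = 1) {i : Fin N} (hi : i ∈ I) :
    D.Aligned σ ↔ edgeSpin σ (D.link i) = 1 := by
  obtain ⟨hcard, hpin⟩ := hI
  obtain ⟨hL, hR⟩ := hpin σ hσ
  have hleft := majority_mul_pos (a := fun j => ((σ (D.left j) : ℤ) : ℝ))
    (fun j => cast_spin_eq_one_or _) hcard hN (cast_spin_eq_one_or (σ (D.left i)))
    (fun j hj => by simp only [hL j hj i hi])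
  have hright := majority_mul_pos (a := fun j => ((σ (D.right j) : ℤ) : ℝ))
    (fun j => cast_spin_eq_one_or _) hcard hN (cast_spin_eq_one_or (σ (D.right i)))
    (fun j hj => by simp only [hR j hj i hi])
  have hmul := mul_pos hleft hright
  rw [D.link_eq, edgeSpin_mk, Aligned]
  push_cast
  rcases cast_spin_eq_one_or (σ (D.left i)) with hu | hu <;>
    rcases cast_spin_eq_one_or (σ (D.right i)) with hv | hv <;>
    simp only [hu, hv] at hmul ⊢ <;> norm_num at hmul ⊢ <;> linarith

theorem openStrong_eq_iff (hτ : τ ⊆ D.strong) :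
    D.openStrong η = τ ↔ ∀ e ∈ D.strong, (η e = true ↔ e ∈ τ) := by
  rw [openStrong, Finset.ext_iff]
  simp only [Finset.mem_filter]
  exact ⟨fun h e he => by simpa only [he, true_and] using h e,
    fun h e => ⟨fun he => (h e he.1).mp he.2, fun he => ⟨hτ he, (h e (hτ he)).mpr he⟩⟩⟩

theorem edgeSpin_of_mem_openStrong (hσ : Consistent G J σ η) {e : G.edgeSet}
    (he : e ∈ D.openStrong η) : edgeSpin σ e = 1 := by
  rw [openStrong, Finset.mem_filter] at he
  exact edgeSpin_eq_one_of_pos (D.strong_pos e he.1) (hσ e he.2)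

theorem abs_mul_edgeSpin (hβ : 0 ≤ β) (σ : Spins V) (e : G.edgeSet) :
    |β * (J e * edgeSpin σ e)| = β * |J e| := by
  rw [abs_mul, abs_mul, abs_edgeSpin, mul_one, abs_of_nonneg hβ]

variable (D)

theorem mem_links {e : G.edgeSet} : e ∈ D.links ↔ ∃ i, D.link i = e := by simp [links]

theorem cluster_subset_core (hτ : τ ⊆ D.strong) {x : V} (hx : x ∈ D.core) :
    cluster τ x ⊆ D.core := fun _ hz =>
  cluster_induction (p := (· ∈ D.core))
    (fun _ _ _ he _ => D.strong_core _ (hτ he) _ (Sym2.mem_mk_right _ _)) hz hx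

theorem aligned_flipOn_block (hτ : τ ⊆ D.strong) (hI : D.IsPinned τ I) (hN : 0 < N)
    (hσ : ∀ e ∈ τ, edgeSpin σ e = 1) : D.Aligned (flipOn D.block σ) ↔ ¬ D.Aligned σ := by
  obtain ⟨i, hi⟩ := hI.nonempty hN
  have hflip : ∀ e ∈ τ, edgeSpin (flipOn D.block σ) e = 1 := fun e he => by
    rw [edgeSpin_flipOn σ (D.strong_block e (hτ he)), hσ e he]
  rw [hI.aligned_iff hN hσ hi, hI.aligned_iff hN hflip hi, D.link_eq, Sym2.eq_swap,
    edgeSpin_flipOn_of_cut σ (D.right_mem i) (D.left_notMem i)]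
  rcases edgeSpin_eq_one_or σ s(D.right i, D.left i) with hs | hs <;> norm_num [hs]

theorem link_abs_bounds (hβ : 0 ≤ β) (hh : 0 < h) (i : Fin N) :
    99 / 100 * h ≤ β * |J (D.link i)| ∧ β * |J (D.link i)| ≤ 101 / 100 * h := by
  have habs : |β * J (D.link i)| = β * |J (D.link i)| := by rw [abs_mul, abs_of_nonneg hβ]
  have hsign : |D.sign i * h| = h := by
    rcases D.sign_eq i with hs | hs <;> simp [hs, hh.le]
  have hdist := (abs_abs_sub_abs_le _ _).trans (D.link_coupling i)
  rw [habs, hsign, abs_le] at hdist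
  constructor <;> linarith

theorem weak_le (hβ : 0 ≤ β) (σ : Spins V) :
    ∏ e ∈ D.weak, Real.exp (β * (J e * edgeSpin σ e)) ≤ Real.exp 1 := by
  rw [← Real.exp_sum, Real.exp_le_exp]
  exact (Finset.sum_le_sum fun e _ =>
    (le_abs_self _).trans (abs_mul_edgeSpin hβ σ e).le).trans D.weak_small

theorem le_weak (hβ : 0 ≤ β) (σ : Spins V) :
    Real.exp (-1) ≤ ∏ e ∈ D.weak, Real.exp (β * (J e * edgeSpin σ e)) := by
  rw [← Real.exp_sum, Real.exp_le_exp]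
  refine (neg_le_neg D.weak_small).trans ?_
  rw [← Finset.sum_neg_distrib]
  refine Finset.sum_le_sum fun e _ => ?_
  rw [← abs_mul_edgeSpin hβ σ e]
  exact neg_abs_le _

/-- The Boltzmann factor of the links, with the open state excluded for the links in `I`. -/
def linkWeight (I : Finset (Fin N)) (σ : Spins V) : ℝ :=
  ∏ i, if i ∈ I then Real.exp (-(β * |J (D.link i)|))
    else Real.exp (β * (J (D.link i) * edgeSpin σ (D.link i)))

theorem linkWeight_nonneg (I : Finset (Fin N)) (σ : Spins V) : 0 ≤ D.linkWeight I σ :=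
  Finset.prod_nonneg fun i _ => by split_ifs <;> exact (Real.exp_pos _).le

theorem linkWeight_le (hβ : 0 ≤ β) (hh : 0 < h) (I : Finset (Fin N)) (σ : Spins V) :
    D.linkWeight I σ ≤ Real.exp (101 / 100 * (h * N) - 2 * h * I.card) := by
  have hterm : ∀ i, (if i ∈ I then Real.exp (-(β * |J (D.link i)|))
          else Real.exp (β * (J (D.link i) * edgeSpin σ (D.link i))))
        ≤ Real.exp (101 / 100 * h - if i ∈ I then 2 * h else 0) := by
    intro i
    have hb := D.link_abs_bounds hβ hh i
    split_ifs with hi <;> rw [Real.exp_le_exp]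
    · linarith
    · linarith [(le_abs_self _).trans (abs_mul_edgeSpin (J := J) hβ σ (D.link i)).le]
  refine (Finset.prod_le_prod (fun i _ => ?_) fun i _ => hterm i).trans (le_of_eq ?_)
  · split_ifs <;> exact (Real.exp_pos _).le
  · rw [← Real.exp_sum, Finset.sum_sub_distrib, Finset.sum_ite_mem, Finset.univ_inter]
    simp only [Finset.sum_const, Finset.card_univ, Fintype.card_fin, nsmul_eq_mul]
    ring_nf

/-- The signs of the links cancel, so only the unpinned links and the fluctuations of the couplings
can make the energy of the links large. -/
theorem le_linkWeight_empty (hh : 0 < h) (hI : D.IsPinned τ I) (hN : 0 < N)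
    (hσ : ∀ e ∈ τ, edgeSpin σ e = 1) :
    Real.exp (-(26 / 100) * (h * N)) ≤ D.linkWeight ∅ σ := by
  obtain ⟨i₀, hi₀⟩ := hI.nonempty hN
  obtain ⟨hcard, hpin⟩ := hI
  obtain ⟨hL, hR⟩ := hpin σ hσ
  have hconst : ∀ i ∈ I, edgeSpin σ (D.link i) = edgeSpin σ (D.link i₀) := fun i hi => by
    simp only [D.link_eq, edgeSpin_mk, hL i hi i₀ hi₀, hR i hi i₀ hi₀]
  have hterm : ∀ i, h * (D.sign i * edgeSpin σ (D.link i₀)) - 2 * h - h / 100 +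
      (if i ∈ I then 2 * h else 0) ≤ β * (J (D.link i) * edgeSpin σ (D.link i)) := by
    intro i
    have hc := abs_le.mp (D.link_coupling i)
    have hlink : D.sign i * h * edgeSpin σ (D.link i) - h / 100
        ≤ β * (J (D.link i) * edgeSpin σ (D.link i)) := by
      rcases edgeSpin_eq_one_or σ (D.link i) with hs | hs <;> rw [hs] <;> linarith
    refine le_trans ?_ hlink
    split_ifs with hi
    · rw [hconst i hi]
      linarith
    · rcases edgeSpin_eq_one_or σ (D.link i) with hs | hs <;>
        rcases edgeSpin_eq_one_or σ (D.link i₀) with hs₀ | hs₀ <;>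
        rcases D.sign_eq i with hi | hi <;> rw [hs, hs₀, hi] <;> linarith
  simp only [linkWeight, Finset.notMem_empty, if_false]
  rw [← Real.exp_sum, Real.exp_le_exp]
  refine le_trans ?_ (Finset.sum_le_sum fun i _ => hterm i)
  rw [Finset.sum_add_distrib, Finset.sum_sub_distrib, Finset.sum_sub_distrib, ← Finset.mul_sum,
    ← Finset.sum_mul, D.sign_sum, Finset.sum_ite_mem, Finset.univ_inter]
  simp only [Finset.sum_const, Finset.card_univ, Fintype.card_fin, nsmul_eq_mul]
  have hcard' : (7 : ℝ) * N ≤ 8 * I.card := by exact_mod_cast hcard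
  nlinarith

theorem link_eq_false (hβ : 0 ≤ β) (hh : 0 < h) (hN : 0 < N)
    (hI : D.IsPinned (D.openStrong η) I) (hσ : Consistent G J σ η) (hσ' : Consistent G J σ' η)
    (hA : D.Aligned σ) (hA' : ¬ D.Aligned σ') {i : Fin N} (hi : i ∈ I) :
    η (D.link i) = false := by
  by_contra hopen
  rw [Bool.not_eq_false] at hopen
  have hJ : J (D.link i) ≠ 0 := by
    intro h0
    have := (D.link_abs_bounds hβ hh i).1
    rw [h0, abs_zero, mul_zero] at this
    linarith
  rw [hI.aligned_iff hN (fun e => edgeSpin_of_mem_openStrong hσ) hi] at hA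
  rw [hI.aligned_iff hN (fun e => edgeSpin_of_mem_openStrong hσ') hi] at hA'
  have hmul := (coupling_mul_spin (hσ' _ hopen)).trans (coupling_mul_spin (hσ _ hopen)).symm
  exact hA' ((mul_left_cancel₀ hJ hmul).trans hA)

end Gadget

end Gadget

theorem sum_ite_forall_prod {ι κ R : Type*} [Fintype ι] [DecidableEq ι] [Fintype κ]
    [CommSemiring R] (p : ι → κ → Prop) [∀ i, DecidablePred (p i)] (w : ι → κ → R) :
    ∑ η : ι → κ, (if ∀ i, p i (η i) then ∏ i, w i (η i) else 0) =
      ∏ i, ∑ b, if p i b then w i b else 0 := by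
  rw [Finset.prod_univ_sum, Fintype.piFinset_univ]
  exact Finset.sum_congr rfl fun η _ => by simp [Finset.prod_ite_zero]

namespace Gadget

variable {V : Type*} [Fintype V] {G : SimpleGraph V} {J : G.edgeSet → ℝ} {β : ℝ}
  {N : ℕ} {h r : ℝ} (D : Gadget G J β N h r)

section Weight

/-- The edges that are neither strong, nor weak, nor links; they avoid the core. -/
def other : Finset G.edgeSet := Finset.univ \ (D.strong ∪ D.weak ∪ D.links)

theorem prod_edges (c : G.edgeSet → ℝ) :
    ∏ e, c e = (∏ e ∈ D.strong, c e) * (∏ e ∈ D.weak, c e) * (∏ i, c (D.link i))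
      * ∏ e ∈ D.other, c e := by
  have hlinks : ∏ i, c (D.link i) = ∏ e ∈ D.links, c e := by
    rw [links, Finset.prod_image fun i _ j _ hij => D.link_injective hij]
  have hweak : Disjoint D.strong D.weak := Finset.disjoint_left.mpr D.disjoint_weak
  have hlink : Disjoint (D.strong ∪ D.weak) D.links := by
    rw [Finset.disjoint_left]
    intro e he hl
    obtain ⟨i, rfl⟩ := D.mem_links.mp hl
    rcases Finset.mem_union.mp he with h | h
    exacts [D.link_notMem_strong i h, D.link_notMem_weak i h]
  rw [hlinks, ← Finset.prod_union hweak, ← Finset.prod_union hlink, other, mul_comm,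
    Finset.prod_sdiff (Finset.subset_univ _)]

theorem mem_other {e : G.edgeSet} :
    e ∈ D.other ↔ e ∉ D.strong ∧ e ∉ D.weak ∧ ∀ i, D.link i ≠ e := by
  simp [other, mem_links]

theorem notMem_core_of_mem_other {e : G.edgeSet} (he : e ∈ D.other) {x : V}
    (hx : x ∈ (e : Sym2 V)) : x ∉ D.core := by
  obtain ⟨hs, hw, hl⟩ := D.mem_other.mp he
  exact D.other_core e hs hw (fun i => (hl i).symm) x hx

/-- Weight of the spins and the open strong edges when weak edges and links are ignored. -/
def weight (τ : Finset G.edgeSet) (σ : Spins V) : ℝ :=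
  (∏ e ∈ D.strong, edgeWeight G J β σ e (decide (e ∈ τ)))
    * ∏ e ∈ D.other, Real.exp (β * (J e * edgeSpin σ e))

/-- Total weight of a set of open strong edges when weak edges and links are ignored. -/
def mass (τ : Finset G.edgeSet) : ℝ := ∑ σ, D.weight τ σ

variable {τ : Finset G.edgeSet} {e : G.edgeSet}

theorem weight_nonneg (hβ : 0 ≤ β) (τ : Finset G.edgeSet) (σ : Spins V) : 0 ≤ D.weight τ σ :=
  mul_nonneg (Finset.prod_nonneg fun e _ => edgeWeight_nonneg hβ σ e _)
    (Finset.prod_nonneg fun _ _ => (Real.exp_pos _).le)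

theorem mass_nonneg (hβ : 0 ≤ β) (τ : Finset G.edgeSet) : 0 ≤ D.mass τ :=
  Finset.sum_nonneg fun σ _ => D.weight_nonneg hβ τ σ

theorem edgeSpin_of_weight_ne_zero (hτ : τ ⊆ D.strong) {σ : Spins V} (hw : D.weight τ σ ≠ 0) :
    ∀ e ∈ τ, edgeSpin σ e = 1 := by
  intro e he
  have hfactor := Finset.prod_ne_zero_iff.mp (left_ne_zero_of_mul hw) e (hτ he)
  refine edgeSpin_eq_one_of_pos (D.strong_pos e (hτ he)) ?_
  by_contra hneg
  exact hfactor (by simp [edgeWeight, he, hneg])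

theorem weight_flipOn {C : Set V} (hC : C ⊆ D.core)
    (hτC : ∀ e ∈ τ, ∀ x ∈ (e : Sym2 V), ∀ y ∈ (e : Sym2 V), x ∈ C → y ∈ C) (σ : Spins V) :
    D.weight τ (flipOn C σ) = D.weight τ σ := by
  unfold weight
  congr 1
  · refine Finset.prod_congr rfl fun e _ => ?_
    unfold edgeWeight
    by_cases he : e ∈ τ
    · rw [edgeSpin_flipOn σ (hτC e he)]
    · simp [he]
  · refine Finset.prod_congr rfl fun e he => ?_
    rw [edgeSpin_flipOn σ fun x hx _ _ hxC => absurd (hC hxC) (D.notMem_core_of_mem_other he hx)]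

/-- Either the ends of `e` are connected by `τ`, or flipping the cluster of one of them exchanges
agreement and disagreement along `e`. -/
theorem mass_le_two_mul (hβ : 0 ≤ β) (hτ : τ ⊆ D.strong) (he : e ∈ D.strong) :
    D.mass τ ≤ 2 * eventWeight (D.weight τ) (fun σ => edgeSpin σ e = 1) := by
  obtain ⟨e, he'⟩ := e
  induction e with
  | _ x y =>
    have hnot := eventWeight_not (D.weight τ) (fun σ => edgeSpin σ s(x, y) = 1)
    suffices hle : eventWeight (D.weight τ) (fun σ => ¬ edgeSpin σ s(x, y) = 1) ≤
        eventWeight (D.weight τ) (fun σ => edgeSpin σ s(x, y) = 1) by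
      rw [mass]
      linarith
    have hcore := D.cluster_subset_core hτ (D.strong_core _ he x (Sym2.mem_mk_left x y))
    refine eventWeight_le_of_perm (D.weight_nonneg hβ τ) (flipOn_involutive (cluster τ x)).toPerm
      (D.weight_flipOn hcore fun e he => cluster_closed he) fun σ hσ hdis => ?_
    have hy : y ∉ cluster τ x := fun hy =>
      hdis (edgeSpin_eq_one_iff.mpr
        (spin_eq_of_mem_cluster (D.edgeSpin_of_weight_ne_zero hτ hσ) hy))
    rw [Function.Involutive.coe_toPerm, edgeSpin_flipOn_of_cut σ (self_mem_cluster τ x) hy,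
      (edgeSpin_eq_one_or σ _).resolve_left hdis, neg_neg]

theorem weight_insert (he : e ∈ D.strong) (heτ : e ∉ τ) (σ : Spins V) :
    D.weight (insert e τ) σ =
      if edgeSpin σ e = 1 then (Real.exp (2 * (β * J e)) - 1) * D.weight τ σ else 0 := by
  have hJ := D.strong_pos e he
  have hrest : ∏ f ∈ D.strong.erase e, edgeWeight G J β σ f (decide (f ∈ insert e τ))
      = ∏ f ∈ D.strong.erase e, edgeWeight G J β σ f (decide (f ∈ τ)) :=
    Finset.prod_congr rfl fun f hf => by simp [Finset.ne_of_mem_erase hf]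
  have hexp : Real.exp (β * J e) = Real.exp (2 * (β * J e)) * Real.exp (-(β * J e)) := by
    rw [← Real.exp_add]
    ring_nf
  have hedge : edgeWeight G J β σ e true = if edgeSpin σ e = 1 then
      (Real.exp (2 * (β * J e)) - 1) * edgeWeight G J β σ e false else 0 := by
    rcases edgeSpin_eq_one_or σ e with hs | hs
    · simp only [edgeWeight, hs, mul_one, hJ.le, abs_of_pos hJ, if_true, Bool.false_eq_true,
        if_false, hexp]
      ring
    · norm_num [edgeWeight, hs, hJ]
  rw [weight, weight, ← Finset.mul_prod_erase _ _ he, ← Finset.mul_prod_erase D.strong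
    (fun f => edgeWeight G J β σ f (decide (f ∈ τ))) he, hrest, decide_eq_true
    (Finset.mem_insert_self e τ), decide_eq_false heτ, hedge]
  split_ifs <;> ring

theorem mass_insert (hβ : 0 ≤ β) (hτ : τ ⊆ D.strong) (he : e ∈ D.strong) (heτ : e ∉ τ) :
    r * D.mass τ ≤ D.mass (insert e τ) := by
  have hmass : D.mass (insert e τ) = (Real.exp (2 * (β * J e)) - 1)
      * eventWeight (D.weight τ) (fun σ => edgeSpin σ e = 1) := by
    simp only [mass, eventWeight, Finset.mul_sum, mul_ite, mul_zero, D.weight_insert he heτ]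
  have hlarge := D.strong_large e he
  have hhalf := D.mass_le_two_mul hβ hτ he
  have hexp : 0 ≤ Real.exp (2 * (β * J e)) - 1 :=
    sub_nonneg.mpr (Real.one_le_exp (by linarith [mul_nonneg hβ (D.strong_pos e he).le]))
  rw [hmass]
  nlinarith [D.mass_nonneg hβ τ]

end Weight

section ClosedWeight

/-- Weight of the spins jointly with the event that the open strong edges are exactly `τ` and the
links in `I` are closed. -/
def closedWeight (τ : Finset G.edgeSet) (I : Finset (Fin N)) (σ : Spins V) : ℝ :=
  ∑ η, if D.openStrong η = τ ∧ ∀ i ∈ I, η (D.link i) = false then jointWeight G J β σ η else 0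

variable {τ : Finset G.edgeSet}

/-- The constraint on the bond configuration is a conjunction of constraints on single edges. -/
theorem closedWeight_eq_prod (hτ : τ ⊆ D.strong) (I : Finset (Fin N)) (σ : Spins V) :
    D.closedWeight τ I σ = ∏ e, ∑ b,
      if (e ∈ D.strong → (b = true ↔ e ∈ τ)) ∧ ∀ i ∈ I, D.link i = e → b = false then
        edgeWeight G J β σ e b else 0 := by
  refine (Finset.sum_congr rfl fun η _ => ?_).trans (sum_ite_forall_prod
    (fun e b => (e ∈ D.strong → (b = true ↔ e ∈ τ)) ∧ ∀ i ∈ I, D.link i = e → b = false)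
    (edgeWeight G J β σ))
  refine if_congr ?_ rfl rfl
  rw [openStrong_eq_iff hτ, forall_and]
  refine and_congr_right fun _ => ⟨?_, fun hη i hi => hη _ i hi rfl⟩
  rintro hη _ i hi rfl
  exact hη i hi

theorem closedWeight_eq (hτ : τ ⊆ D.strong) (I : Finset (Fin N)) (σ : Spins V) :
    D.closedWeight τ I σ = D.weight τ σ
      * (∏ e ∈ D.weak, Real.exp (β * (J e * edgeSpin σ e))) * D.linkWeight I σ := by
  have hfree : ∀ e, e ∉ D.strong → (∀ i, D.link i ≠ e) →
      (∑ b, if (e ∈ D.strong → (b = true ↔ e ∈ τ)) ∧ ∀ i ∈ I, D.link i = e → b = false then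
        edgeWeight G J β σ e b else 0) = Real.exp (β * (J e * edgeSpin σ e)) := by
    intro e hs hl
    simp only [hs, hl, false_imp_iff, implies_true, and_self, if_true, edgeWeight_sum]
  rw [D.closedWeight_eq_prod hτ, D.prod_edges, weight, linkWeight, mul_right_comm,
    mul_right_comm (∏ e ∈ D.strong, _)]
  congr 1
  · congr 1
    · congr 1
      · refine Finset.prod_congr rfl fun e he => ?_
        have hlink : ∀ i, D.link i ≠ e := fun i hi => D.link_notMem_strong i (hi ▸ he)
        by_cases heτ : e ∈ τ <;> simp [he, hlink, heτ]
      · exact Finset.prod_congr rfl fun e he =>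
          hfree e (D.mem_other.mp he).1 (D.mem_other.mp he).2.2
    · exact Finset.prod_congr rfl fun e he => hfree e (fun hs => D.disjoint_weak e hs he)
        fun i hi => D.link_notMem_weak i (hi ▸ he)
  · refine Finset.prod_congr rfl fun i _ => ?_
    by_cases hi : i ∈ I
    · simp [D.link_notMem_strong i, D.link_injective.eq_iff, hi, edgeWeight]
    · simp [D.link_notMem_strong i, D.link_injective.eq_iff, hi, ← edgeWeight_sum]

end ClosedWeight

end Gadget

namespace Gadget

variable {V : Type*} [Fintype V] {G : SimpleGraph V} {J : G.edgeSet → ℝ} {β : ℝ}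
  {N : ℕ} {h r : ℝ} (D : Gadget G J β N h r)

section Bounds

variable {τ : Finset G.edgeSet} {I : Finset (Fin N)} {σ : Spins V}

theorem closedWeight_nonneg (hβ : 0 ≤ β) (τ : Finset G.edgeSet) (I : Finset (Fin N))
    (σ : Spins V) : 0 ≤ D.closedWeight τ I σ :=
  Finset.sum_nonneg fun η _ => by
    split_ifs
    exacts [jointWeight_nonneg hβ σ η, le_rfl]

theorem sum_openStrong (F : (G.edgeSet → Bool) → ℝ) :
    ∑ η, F η = ∑ τ ∈ D.strong.powerset, ∑ η, if D.openStrong η = τ then F η else 0 := by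
  rw [Finset.sum_comm]
  refine Finset.sum_congr rfl fun η _ => ?_
  have hsubset : D.openStrong η ⊆ D.strong := Finset.filter_subset _ _
  rw [Finset.sum_ite_eq, if_pos (Finset.mem_powerset.mpr hsubset)]

theorem boltzmann_eq_sum (σ : Spins V) :
    boltzmann G J β σ = ∑ τ ∈ D.strong.powerset, D.closedWeight τ ∅ σ := by
  rw [← jointWeight_sum, D.sum_openStrong]
  simp only [closedWeight, Finset.notMem_empty, false_imp_iff, implies_true, and_true]

/-- Total weight when weak edges and links are ignored. -/
def total : ℝ := ∑ τ ∈ D.strong.powerset, D.mass τ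

/-- The part of the total weight in which the open strong edges do not pin the link ends. -/
def unpinnedMass : ℝ := ∑ τ ∈ D.strong.powerset, if ∃ I, D.IsPinned τ I then 0 else D.mass τ

theorem total_sub_unpinnedMass :
    D.total - D.unpinnedMass =
      ∑ τ ∈ D.strong.powerset, if ∃ I, D.IsPinned τ I then D.mass τ else 0 := by
  rw [total, unpinnedMass, ← Finset.sum_sub_distrib]
  exact Finset.sum_congr rfl fun τ _ => by split_ifs <;> simp

theorem total_pos (hβ : 0 ≤ β) : 0 < D.total := by
  refine lt_of_lt_of_le ?_ (Finset.single_le_sum (fun τ _ => D.mass_nonneg hβ τ)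
    (Finset.empty_mem_powerset D.strong))
  refine Finset.sum_pos (fun σ _ => mul_pos ?_ ?_) Finset.univ_nonempty
  · exact Finset.prod_pos fun e _ => by simp [edgeWeight, Real.exp_pos]
  · exact Finset.prod_pos fun e _ => Real.exp_pos _

theorem weight_flipOn_block (hτ : τ ⊆ D.strong) (σ : Spins V) :
    D.weight τ (flipOn D.block σ) = D.weight τ σ :=
  D.weight_flipOn D.block_core (fun e he => D.strong_block e (hτ he)) σ

theorem mass_le_two_mul_aligned (hβ : 0 ≤ β) (hτ : τ ⊆ D.strong) (hI : D.IsPinned τ I)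
    (hN : 0 < N) : D.mass τ ≤ 2 * eventWeight (D.weight τ) D.Aligned := by
  have hflip : eventWeight (D.weight τ) (fun σ => ¬ D.Aligned σ) ≤
      eventWeight (D.weight τ) D.Aligned :=
    eventWeight_le_of_perm (D.weight_nonneg hβ τ) (flipOn_involutive D.block).toPerm
      (D.weight_flipOn_block hτ) fun _ hσ =>
      (D.aligned_flipOn_block hτ hI hN (D.edgeSpin_of_weight_ne_zero hτ hσ)).mpr
  rw [eventWeight_not, ← mass] at hflip
  linarith

theorem mass_le_two_mul_not_aligned (hβ : 0 ≤ β) (hτ : τ ⊆ D.strong) (hI : D.IsPinned τ I)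
    (hN : 0 < N) : D.mass τ ≤ 2 * eventWeight (D.weight τ) fun σ => ¬ D.Aligned σ := by
  have hflip : eventWeight (D.weight τ) D.Aligned ≤
      eventWeight (D.weight τ) (fun σ => ¬ D.Aligned σ) :=
    eventWeight_le_of_perm (D.weight_nonneg hβ τ) (flipOn_involutive D.block).toPerm
      (D.weight_flipOn_block hτ) fun _ hσ hA hA' =>
      (D.aligned_flipOn_block hτ hI hN (D.edgeSpin_of_weight_ne_zero hτ hσ)).mp hA' hA
  rw [eventWeight_not, ← mass] at hflip ⊢
  linarith

theorem le_closedWeight_empty (hβ : 0 ≤ β) (hh : 0 < h) (hN : 0 < N) (hτ : τ ⊆ D.strong)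
    (hI : D.IsPinned τ I) (σ : Spins V) :
    Real.exp (-1 - 26 / 100 * (h * N)) * D.weight τ σ ≤ D.closedWeight τ ∅ σ := by
  by_cases hw : D.weight τ σ = 0
  · rw [hw, mul_zero]
    exact D.closedWeight_nonneg hβ τ ∅ σ
  rw [sub_eq_add_neg, ← neg_mul, Real.exp_add, D.closedWeight_eq hτ, mul_assoc (D.weight τ σ),
    mul_comm]
  exact mul_le_mul_of_nonneg_left (mul_le_mul (D.le_weak hβ σ)
    (D.le_linkWeight_empty hh hI hN (D.edgeSpin_of_weight_ne_zero hτ hw)) (Real.exp_pos _).le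
    ((Real.exp_pos _).le.trans (D.le_weak hβ σ))) (D.weight_nonneg hβ τ σ)

/-- Pinned configurations are typical, and given one of them the event `A` is a fair coin toss
before links and weak edges are taken into account. -/
theorem le_eventWeight_boltzmann (hβ : 0 ≤ β) (hh : 0 < h) (hN : 0 < N) {A : Spins V → Prop}
    (hA : ∀ τ ⊆ D.strong, ∀ I, D.IsPinned τ I → D.mass τ ≤ 2 * eventWeight (D.weight τ) A)
    (hunpinned : D.unpinnedMass ≤ 1 / 2 * D.total) :
    Real.exp (-1 - 26 / 100 * (h * N)) / 4 * D.total ≤ eventWeight (boltzmann G J β) A := by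
  set κ := Real.exp (-1 - 26 / 100 * (h * N))
  have hκ0 : 0 < κ := Real.exp_pos _
  have hsum : eventWeight (boltzmann G J β) A =
      ∑ τ ∈ D.strong.powerset, eventWeight (D.closedWeight τ ∅) A := by
    simp only [eventWeight, D.boltzmann_eq_sum]
    rw [Finset.sum_comm]
    exact Finset.sum_congr rfl fun σ _ => by split_ifs <;> simp
  have hterm : ∀ τ ∈ D.strong.powerset,
      κ / 2 * (if ∃ I, D.IsPinned τ I then D.mass τ else 0)
        ≤ eventWeight (D.closedWeight τ ∅) A := by
    intro τ hτ
    rw [Finset.mem_powerset] at hτ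
    split_ifs with hI
    · obtain ⟨I, hI⟩ := hI
      calc κ / 2 * D.mass τ ≤ κ * eventWeight (D.weight τ) A := by nlinarith [hA τ hτ I hI]
        _ = eventWeight (fun σ => κ * D.weight τ σ) A := (eventWeight_const_mul _ _ _).symm
        _ ≤ _ := eventWeight_mono fun σ _ => D.le_closedWeight_empty hβ hh hN hτ hI σ
    · rw [mul_zero]
      exact eventWeight_nonneg (D.closedWeight_nonneg hβ τ ∅) A
  calc κ / 4 * D.total ≤ κ / 2 * (D.total - D.unpinnedMass) := by nlinarith
    _ ≤ _ := by
      rw [hsum, total_sub_unpinnedMass, Finset.mul_sum]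
      exact Finset.sum_le_sum hterm

/-- An undetermined alignment forces all pinned links to be closed. -/
theorem sum_undetermined_le_closedWeight (hβ : 0 ≤ β) (hh : 0 < h) (hN : 0 < N) (σ : Spins V) :
    (∑ η, if D.Aligned σ ∧ ∃ σ', ¬ D.Aligned σ' ∧ Consistent G J σ' η then
        jointWeight G J β σ η else 0) ≤
      ∑ τ ∈ D.strong.powerset, D.closedWeight τ (D.pinnedLinks τ) σ := by
  rw [D.sum_openStrong]
  refine Finset.sum_le_sum fun τ _ => Finset.sum_le_sum fun η _ => ?_
  by_cases h0 : jointWeight G J β σ η = 0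
  · simp [h0]
  have hσ : Consistent G J σ η := by
    by_contra hσ
    exact h0 (by rw [jointWeight_eq, if_neg hσ])
  by_cases hdet : D.openStrong η = τ ∧ D.Aligned σ ∧ ∃ σ', ¬ D.Aligned σ' ∧ Consistent G J σ' η
  · obtain ⟨rfl, hA, σ', hA', hσ'⟩ := hdet
    have hclosed : ∀ i ∈ D.pinnedLinks (D.openStrong η), η (D.link i) = false := fun i hi =>
      D.link_eq_false hβ hh hN (isPinned_pinnedLinks (exists_isPinned_of_mem_pinnedLinks hi))
        hσ hσ' hA hA' hi
    rw [if_pos rfl, if_pos ⟨hA, σ', hA', hσ'⟩, if_pos ⟨rfl, hclosed⟩]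
  · rw [← ite_and, if_neg hdet]
    split_ifs
    exacts [jointWeight_nonneg hβ σ η, le_rfl]

theorem sum_closedWeight_le (hβ : 0 ≤ β) (hh : 0 < h) (hτ : τ ⊆ D.strong) (I : Finset (Fin N)) :
    ∑ σ, D.closedWeight τ I σ ≤
      Real.exp (1 + (101 / 100 * (h * N) - 2 * h * I.card)) * D.mass τ := by
  rw [mass, Finset.mul_sum]
  refine Finset.sum_le_sum fun σ _ => ?_
  rw [D.closedWeight_eq hτ, Real.exp_add, mul_comm _ (D.weight τ σ), mul_assoc]
  exact mul_le_mul_of_nonneg_left (mul_le_mul (D.weak_le hβ σ) (D.linkWeight_le hβ hh I σ)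
    (D.linkWeight_nonneg I σ) (Real.exp_pos _).le) (D.weight_nonneg hβ τ σ)

theorem sum_closedWeight_pinnedLinks_le (hβ : 0 ≤ β) (hh : 0 < h) (hτ : τ ⊆ D.strong) :
    ∑ σ, D.closedWeight τ (D.pinnedLinks τ) σ ≤
      Real.exp (1 + 101 / 100 * (h * N)) * (if ∃ I, D.IsPinned τ I then 0 else D.mass τ)
        + Real.exp (1 - 74 / 100 * (h * N)) * D.mass τ := by
  have hmass := D.mass_nonneg hβ τ
  refine (D.sum_closedWeight_le hβ hh hτ _).trans ?_
  split_ifs with hI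
  · rw [mul_zero, zero_add]
    refine mul_le_mul_of_nonneg_right (Real.exp_le_exp.mpr ?_) hmass
    have hcard : (7 : ℝ) * N ≤ 8 * (D.pinnedLinks τ).card := by
      exact_mod_cast (isPinned_pinnedLinks hI).1
    nlinarith
  · have hpos := mul_nonneg (Real.exp_pos (1 - 74 / 100 * (h * N))).le hmass
    simp only [pinnedLinks, dif_neg hI, Finset.card_empty, Nat.cast_zero, mul_zero, sub_zero]
    linarith

theorem flow_mul_le (hβ : 0 ≤ β) (hh : 0 < h) (hN : 0 < N) :
    flow (swMatrix G J β) (gibbs G J β) D.Aligned * ∑ ω, boltzmann G J β ω ≤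
      Real.exp (1 + 101 / 100 * (h * N)) * D.unpinnedMass
        + Real.exp (1 - 74 / 100 * (h * N)) * D.total := by
  refine (flow_swMatrix_le hβ D.Aligned).trans ?_
  refine (Finset.sum_le_sum fun σ _ => D.sum_undetermined_le_closedWeight hβ hh hN σ).trans ?_
  rw [Finset.sum_comm, unpinnedMass, total, Finset.mul_sum, Finset.mul_sum,
    ← Finset.sum_add_distrib]
  exact Finset.sum_le_sum fun τ hτ =>
    D.sum_closedWeight_pinnedLinks_le hβ hh (Finset.mem_powerset.mp hτ)

end Bounds

end Gadget

section Slow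

/-- An upper bound for the spectral gap of a chain containing a gadget whose links have total
strength `M`. -/
def gapBound (M : ℝ) : ℝ := 16 * Real.exp (2 - 4 / 10 * M)

theorem gapBound_nonneg (M : ℝ) : 0 ≤ gapBound M := by
  unfold gapBound
  positivity

theorem le_mul_div_mul_div {f m a b Z g : ℝ} (hm : 0 < m) (ha : m ≤ a) (hb : m ≤ b)
    (hab : a + b = Z) (hg : 0 ≤ g) (hf : f * Z ≤ g / 2 * m) : f ≤ g * (a / Z * (b / Z)) := by
  have hZ : 0 < Z := by linarith
  have hmZ : m * Z ≤ 2 * (a * b) := by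
    rw [← hab]
    nlinarith
  rw [div_mul_div_comm, ← mul_div_assoc, le_div_iff₀ (by positivity)]
  nlinarith [mul_le_mul_of_nonneg_right hf hZ.le]

namespace Gadget

variable {V : Type*} [Fintype V] {G : SimpleGraph V} {J : G.edgeSet → ℝ} {β : ℝ}
  {N : ℕ} {h r : ℝ} (D : Gadget G J β N h r)

theorem unpinnedMass_le (hβ : 0 ≤ β) (hr : 0 ≤ r) (F : Finset (Finset G.edgeSet))
    (hF : ∀ W ∈ F, W ⊆ D.strong)
    (hpin : ∀ τ ⊆ D.strong, (∀ W ∈ F, ∃ e ∈ W, e ∈ τ) → ∃ I, D.IsPinned τ I)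
    {p : ℝ} (hp : ∑ W ∈ F, ((1 + r)⁻¹) ^ W.card ≤ p) :
    D.unpinnedMass ≤ p * D.total :=
  (sum_not_good_le hr (D.mass_nonneg hβ) (fun _ hτ _ he heτ => D.mass_insert hβ hτ he heτ) F hF
    (fun τ => ∃ I, D.IsPinned τ I) hpin).trans
    (mul_le_mul_of_nonneg_right hp (D.total_pos hβ).le)

theorem flow_mul_le_gapBound (hβ : 0 ≤ β) (hh : 0 < h) (hN : 0 < N)
    (hunpinned : D.unpinnedMass ≤ Real.exp (-3 * (h * N)) * D.total) :
    flow (swMatrix G J β) (gibbs G J β) D.Aligned * ∑ ω, boltzmann G J β ω ≤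
      gapBound (h * N) / 2 * (Real.exp (-1 - 26 / 100 * (h * N)) / 4 * D.total) := by
  have hM : 0 ≤ h * N := by positivity
  have hT := D.total_pos hβ
  have hexp : Real.exp (2 - 4 / 10 * (h * N)) * Real.exp (-1 - 26 / 100 * (h * N)) =
      Real.exp (1 - 66 / 100 * (h * N)) := by
    rw [← Real.exp_add]
    ring_nf
  have hbad : Real.exp (1 + 101 / 100 * (h * N)) * Real.exp (-3 * (h * N)) ≤
      Real.exp (1 - 66 / 100 * (h * N)) := by
    rw [← Real.exp_add, Real.exp_le_exp]
    linarith
  have hclosed : Real.exp (1 - 74 / 100 * (h * N)) ≤ Real.exp (1 - 66 / 100 * (h * N)) := by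
    rw [Real.exp_le_exp]
    linarith
  calc _ ≤ _ := D.flow_mul_le hβ hh hN
    _ ≤ Real.exp (1 + 101 / 100 * (h * N)) * (Real.exp (-3 * (h * N)) * D.total)
        + Real.exp (1 - 74 / 100 * (h * N)) * D.total := by gcongr
    _ ≤ Real.exp (1 - 66 / 100 * (h * N)) * D.total
        + Real.exp (1 - 66 / 100 * (h * N)) * D.total := by
      rw [← mul_assoc]
      gcongr
    _ = _ := by
      rw [← hexp, gapBound]
      ring

theorem isSlow (hβ : 0 ≤ β) (hh : 0 < h) (hN : 0 < N)
    (hunpinned : D.unpinnedMass ≤ 1 / 2 * D.total)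
    (hunpinned' : D.unpinnedMass ≤ Real.exp (-3 * (h * N)) * D.total)
    (hgap : gapBound (h * N) < 1) :
    IsSlow (swMatrix G J β) (gibbs G J β) (gapBound (h * N)) := by
  set π := gibbs G J β
  have hZ := sum_boltzmann_pos (G := G) (J := J) (β := β)
  set Z := ∑ ω, boltzmann G J β ω
  have hm : 0 < Real.exp (-1 - 26 / 100 * (h * N)) / 4 * D.total :=
    mul_pos (by positivity) (D.total_pos hβ)
  have hflow := D.flow_mul_le_gapBound hβ hh hN hunpinned'
  set m := Real.exp (-1 - 26 / 100 * (h * N)) / 4 * D.total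
  have ha := D.le_eventWeight_boltzmann hβ hh hN
    (fun τ hτ I hI => D.mass_le_two_mul_aligned hβ hτ hI hN) hunpinned
  have hb := D.le_eventWeight_boltzmann hβ hh hN
    (fun τ hτ I hI => D.mass_le_two_mul_not_aligned hβ hτ hI hN) hunpinned
  have hab := eventWeight_not (boltzmann G J β) D.Aligned
  have hgibbs : ∀ A : Spins V → Prop, eventWeight π A = eventWeight (boltzmann G J β) A / Z :=
    fun A => eventWeight_div_const (boltzmann G J β) Z A
  refine (isReversibleChain_swMatrix hβ).bottleneck D.Aligned hgap ?_ ?_ ?_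
  · rw [hgibbs]
    exact div_pos (hm.trans_le ha) hZ
  · rw [hgibbs]
    exact div_pos (hm.trans_le hb) hZ
  · rw [hgibbs, hgibbs]
    exact le_mul_div_mul_div hm ha hb (by linarith) (gapBound_nonneg _) hflow

end Gadget

end Slow

/-! ### Renormalization in the quadrant -/

section Covers

variable {E : Type*}

/-- The event `Bad` on the set of open edges is covered by the events "all edges of `W` are
closed", where `W` ranges over a family of subsets of `S` with `∑ q ^ |W| ≤ p`. If closed sets have
probability at most `q ^ |W|`, this is a union bound by `p` which survives conditioning. -/
def Cover (q : ℝ) (S : E → Prop) (Bad : Set E → Prop) (p : ℝ) : Prop :=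
  ∃ F : Finset (Finset E), (∀ W ∈ F, ∀ e ∈ W, S e) ∧ ∑ W ∈ F, q ^ W.card ≤ p ∧
    ∀ η, Bad η → ∃ W ∈ F, ∀ e ∈ W, e ∉ η

namespace Cover

variable {q : ℝ} {S S' : E → Prop} {Bad Bad' : Set E → Prop} {p p' : ℝ}

theorem mono (h : Cover q S Bad p) (hS : ∀ e, S e → S' e) (hB : ∀ η, Bad' η → Bad η)
    (hp : p ≤ p') : Cover q S' Bad' p' := by
  obtain ⟨F, hF, hsum, hcover⟩ := h
  exact ⟨F, fun W hW e he => hS e (hF W hW e he), hsum.trans hp, fun η hη => hcover η (hB η hη)⟩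

theorem of_false (hB : ∀ η, ¬ Bad η) : Cover q S Bad 0 :=
  ⟨∅, by simp, by simp, fun η hη => absurd hη (hB η)⟩

theorem closed (W : Finset E) (hW : ∀ e ∈ W, S e) :
    Cover q S (fun η => ∀ e ∈ W, e ∉ η) (q ^ W.card) :=
  ⟨{W}, by simpa using hW, by simp, fun η hη => ⟨W, by simp, hη⟩⟩

theorem or (hq : 0 ≤ q) (h : Cover q S Bad p) (h' : Cover q S Bad' p') :
    Cover q S (fun η => Bad η ∨ Bad' η) (p + p') := by
  obtain ⟨F, hF, hsum, hcover⟩ := h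
  obtain ⟨F', hF', hsum', hcover'⟩ := h'
  refine ⟨F ∪ F', fun W hW => (Finset.mem_union.mp hW).elim (hF W) (hF' W), ?_, ?_⟩
  · have hunion := Finset.sum_union_inter (s₁ := F) (s₂ := F') (f := fun W => q ^ W.card)
    have hinter : 0 ≤ ∑ W ∈ F ∩ F', q ^ W.card := Finset.sum_nonneg fun W _ => pow_nonneg hq _
    linarith
  · rintro η (hη | hη)
    · obtain ⟨W, hW, hclosed⟩ := hcover η hη
      exact ⟨W, Finset.mem_union_left _ hW, hclosed⟩
    · obtain ⟨W, hW, hclosed⟩ := hcover' η hη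
      exact ⟨W, Finset.mem_union_right _ hW, hclosed⟩

theorem exists_mem {ι : Type*} (hq : 0 ≤ q) (T : Finset ι) {Bad : ι → Set E → Prop}
    {p : ι → ℝ} (h : ∀ i ∈ T, Cover q S (Bad i) (p i)) :
    Cover q S (fun η => ∃ i ∈ T, Bad i η) (∑ i ∈ T, p i) := by
  induction T using Finset.induction_on with
  | empty => exact of_false (by simp)
  | insert i T hi ih =>
    rw [Finset.sum_insert hi]
    simpa only [Finset.exists_mem_insert] using (h i (Finset.mem_insert_self i T)).or hq
      (ih fun j hj => h j (Finset.mem_insert_of_mem hj))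

theorem and (hq : 0 ≤ q) (hp : 0 ≤ p) (hSS : ∀ e, S e → ¬ S' e) (h : Cover q S Bad p)
    (h' : Cover q S' Bad' p') :
    Cover q (fun e => S e ∨ S' e) (fun η => Bad η ∧ Bad' η) (p * p') := by
  obtain ⟨F, hF, hsum, hcover⟩ := h
  obtain ⟨F', hF', hsum', hcover'⟩ := h'
  refine ⟨(F ×ˢ F').image fun w => w.1 ∪ w.2, ?_, ?_, ?_⟩
  · intro W hW e he
    obtain ⟨w, hw, rfl⟩ := Finset.mem_image.mp hW
    rw [Finset.mem_product] at hw
    exact (Finset.mem_union.mp he).imp (hF _ hw.1 e) (hF' _ hw.2 e)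
  · calc ∑ W ∈ (F ×ˢ F').image fun w => w.1 ∪ w.2, q ^ W.card
        ≤ ∑ w ∈ F ×ˢ F', q ^ (w.1 ∪ w.2).card :=
          Finset.sum_image_le_of_nonneg (f := fun W : Finset E => q ^ W.card)
            fun w _ => pow_nonneg hq _
      _ = ∑ w ∈ F ×ˢ F', q ^ w.1.card * q ^ w.2.card := by
          refine Finset.sum_congr rfl fun w hw => ?_
          rw [Finset.mem_product] at hw
          rw [Finset.card_union_of_disjoint, pow_add]
          rw [Finset.disjoint_left]
          exact fun e he he' => hSS e (hF _ hw.1 e he) (hF' _ hw.2 e he')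
      _ = (∑ W ∈ F, q ^ W.card) * ∑ W ∈ F', q ^ W.card := by
          rw [Finset.sum_mul_sum, Finset.sum_product]
      _ ≤ p * p' := mul_le_mul hsum hsum' (Finset.sum_nonneg fun W _ => pow_nonneg hq _) hp
  · rintro η ⟨hB, hB'⟩
    obtain ⟨W, hW, hclosed⟩ := hcover η hB
    obtain ⟨W', hW', hclosed'⟩ := hcover' η hB'
    exact ⟨W ∪ W', Finset.mem_image.mpr ⟨(W, W'), Finset.mem_product.mpr ⟨hW, hW'⟩, rfl⟩,
      fun e he => (Finset.mem_union.mp he).elim (hclosed e) (hclosed' e)⟩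

end Cover

end Covers

section Grid

/-- Edges of the quadrant `ℕ²`: `((x, y), false)` joins `(x, y)` to `(x + 1, y)` and
`((x, y), true)` joins `(x, y)` to `(x, y + 1)`. -/
abbrev GridEdge : Type := (ℕ × ℕ) × Bool

/-- The coordinate of `a` in direction `d`, where `false` is the first direction. -/
def coord (d : Bool) (a : ℕ × ℕ) : ℕ := if d then a.2 else a.1

/-- The point with coordinate `x` in direction `d` and `y` in the other direction. -/
def point (d : Bool) (x y : ℕ) : ℕ × ℕ := if d then (y, x) else (x, y)

/-- The neighbour of `a` in direction `d`. -/
def step (a : ℕ × ℕ) (d : Bool) : ℕ × ℕ := if d then (a.1, a.2 + 1) else (a.1 + 1, a.2)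

theorem coord_point (d : Bool) (x y : ℕ) : coord d (point d x y) = x := by
  cases d <;> rfl

theorem coord_not_point (d : Bool) (x y : ℕ) : coord (!d) (point d x y) = y := by
  cases d <;> rfl

theorem point_coord (d : Bool) (a : ℕ × ℕ) : point d (coord d a) (coord (!d) a) = a := by
  cases d <;> rfl

theorem step_point_not (d : Bool) (x y : ℕ) : step (point d x y) (!d) = point d x (y + 1) := by
  cases d <;> rfl

/-- `a` lies in the square of side `n` with index `u`, that is, in
`[n u₁, n (u₁ + 1)) × [n u₂, n (u₂ + 1))`. -/
def InBlock (n : ℕ) (u a : ℕ × ℕ) : Prop := a.1 / n = u.1 ∧ a.2 / n = u.2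

theorem InBlock.coord_div {n : ℕ} {u a : ℕ × ℕ} (h : InBlock n u a) (d : Bool) :
    coord d a / n = coord d u := by
  cases d
  exacts [h.1, h.2]

theorem inBlock_point {n : ℕ} {u : ℕ × ℕ} {d : Bool} {x y : ℕ} (hx : x / n = coord d u)
    (hy : y / n = coord (!d) u) : InBlock n u (point d x y) := by
  cases d
  exacts [⟨hx, hy⟩, ⟨hy, hx⟩]

theorem inBlock_mul {n m : ℕ} {u a : ℕ × ℕ} :
    InBlock (m * n) u a ↔ InBlock m u (a.1 / n, a.2 / n) := by
  simp only [InBlock, Nat.div_div_eq_div_mul, mul_comm m n]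

theorem InBlock.mul {n m : ℕ} {u v a : ℕ × ℕ} (hv : InBlock m u v) (ha : InBlock n v a) :
    InBlock (m * n) u a := by
  rwa [inBlock_mul, ha.1, ha.2]

theorem InBlock.unique {n : ℕ} {u v a : ℕ × ℕ} (hu : InBlock n u a) (hv : InBlock n v a) : u = v :=
  Prod.ext (hu.1.symm.trans hv.1) (hu.2.symm.trans hv.2)

/-- The edge lies inside the square of side `n` with index `u`. -/
def EdgeIn (n : ℕ) (u : ℕ × ℕ) (e : GridEdge) : Prop := InBlock n u e.1 ∧ InBlock n u (step e.1 e.2)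

theorem EdgeIn.mul {n m : ℕ} {u v : ℕ × ℕ} (hv : InBlock m u v) {e : GridEdge}
    (he : EdgeIn n v e) : EdgeIn (m * n) u e :=
  ⟨hv.mul he.1, hv.mul he.2⟩

theorem mul_add_div_self {n v t : ℕ} (ht : t < n) : (v * n + t) / n = v := by
  rw [mul_comm, Nat.mul_add_div (by omega), Nat.div_eq_of_lt ht, add_zero]

/-- The `t`-th edge joining the square `v` of side `n` to the next one in direction `d`. -/
def face (n : ℕ) (v : ℕ × ℕ) (d : Bool) (t : ℕ) : GridEdge :=
  (point d (coord d v * n + (n - 1)) (coord (!d) v * n + t), d)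

theorem step_face {n : ℕ} (hn : 0 < n) (v : ℕ × ℕ) (d : Bool) (t : ℕ) :
    step (face n v d t).1 (face n v d t).2 =
      point d (coord d (step v d) * n) (coord (!d) (step v d) * n + t) := by
  have hnext : ∀ w, w * n + (n - 1) + 1 = (w + 1) * n := fun w => by
    rw [add_mul, one_mul]
    omega
  cases d <;> simp [face, point, step, coord, hnext]

theorem face_fst {n : ℕ} (hn : 0 < n) (v : ℕ × ℕ) (d : Bool) {t : ℕ} (ht : t < n) :
    InBlock n v (face n v d t).1 :=
  inBlock_point (mul_add_div_self (Nat.sub_lt hn one_pos)) (mul_add_div_self ht)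

theorem face_snd {n : ℕ} (hn : 0 < n) (v : ℕ × ℕ) (d : Bool) {t : ℕ} (ht : t < n) :
    InBlock n (step v d) (step (face n v d t).1 (face n v d t).2) := by
  rw [step_face hn]
  exact inBlock_point (Nat.mul_div_cancel _ hn) (mul_add_div_self ht)

theorem face_injective {n : ℕ} (v : ℕ × ℕ) (d : Bool) : Function.Injective (face n v d) := by
  intro s t h
  cases d <;> simpa [face, point] using h

theorem edgeIn_face {n m : ℕ} (hn : 0 < n) {u v : ℕ × ℕ} {d : Bool} (hv : InBlock m u v)
    (hvd : InBlock m u (step v d)) {t : ℕ} (ht : t < n) : EdgeIn (m * n) u (face n v d t) :=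
  ⟨hv.mul (face_fst hn v d ht), hvd.mul (face_snd hn v d ht)⟩

theorem eq_of_div_eq {α : Type*} {g : ℕ → α} {m w : ℕ}
    (hg : ∀ x, x / m = w → (x + 1) / m = w → g x = g (x + 1)) {x y : ℕ} (hx : x / m = w)
    (hy : y / m = w) : g x = g y := by
  wlog hxy : x ≤ y generalizing x y
  · exact (this hy hx (le_of_not_ge hxy)).symm
  induction y, hxy using Nat.le_induction with
  | base => rfl
  | succ y hxy ih =>
    have hy' : y / m = w :=
      le_antisymm ((Nat.div_le_div_right y.le_succ).trans hy.le)
        (hx.ge.trans (Nat.div_le_div_right hxy))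
    exact (ih hy').trans (hg y hy' hy)

theorem eq_of_inBlock_of_ne {α : Type*} {g : ℕ × ℕ → α} {m : ℕ} (hm : 2 ≤ m) {u v₀ : ℕ × ℕ}
    (hg : ∀ v d, InBlock m u v → InBlock m u (step v d) → v ≠ v₀ → step v d ≠ v₀ →
      g v = g (step v d)) {v w : ℕ × ℕ} (hv : InBlock m u v) (hw : InBlock m u w)
    (hv₀ : v ≠ v₀) (hw₀ : w ≠ v₀) : g v = g w := by
  have line : ∀ (d : Bool) {i x y : ℕ}, i / m = coord d u → i ≠ coord d v₀ →
      x / m = coord (!d) u → y / m = coord (!d) u → g (point d i x) = g (point d i y) := by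
    intro d i x y hi hi₀ hx hy
    have hne : ∀ z, point d i z ≠ v₀ := fun z hz => hi₀ (by rw [← hz, coord_point])
    refine eq_of_div_eq (g := fun z => g (point d i z)) (fun z hz hz' => ?_) hx hy
    have hgz := hg (point d i z) (!d)
    rw [step_point_not] at hgz
    exact hgz (inBlock_point hi hz) (inBlock_point hi hz') (hne _) (hne _)
  have pick : ∀ d : Bool, ∃ x, x / m = coord d u ∧ x ≠ coord d v₀ := by
    intro d
    by_cases h : coord d u * m = coord d v₀
    · exact ⟨coord d u * m + 1, mul_add_div_self (by omega), by omega⟩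
    · exact ⟨coord d u * m, Nat.mul_div_cancel _ (by omega), h⟩
  choose c hc hc₀ using pick
  -- `v` differs from `v₀` in some coordinate `d`: move along the line of `v` on which that
  -- coordinate is fixed, then along a line which avoids `v₀` in the other coordinate
  suffices key : ∀ v, InBlock m u v → v ≠ v₀ → g v = g (point false (c false) (c true)) from
    (key v hv hv₀).trans (key w hw hw₀).symm
  intro v hv hv₀
  obtain ⟨d, hd⟩ : ∃ d, coord d v ≠ coord d v₀ := by
    by_contra! h
    exact hv₀ (Prod.ext (h false) (h true))
  have hcross := line d (hv.coord_div d) hd (hv.coord_div (!d)) (hc (!d))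
  rw [point_coord] at hcross
  cases d
  · exact hcross.trans (line true (hc true) (hc₀ true) (hv.coord_div false) (hc false))
  · exact hcross.trans (line false (hc false) (hc₀ false) (hv.coord_div true) (hc true))

end Grid

section Percolation

/-- Every spin configuration that is constant along the edges in `η` is constant on `C`; this
expresses, without paths, that the open edges connect the points of `C`. -/
def Linked (η : Set GridEdge) (C : Finset (ℕ × ℕ)) : Prop :=
  ∀ σ : ℕ × ℕ → ℤˣ, (∀ e ∈ η, σ e.1 = σ (step e.1 e.2)) → ∀ a ∈ C, ∀ b ∈ C, σ a = σ b

/-- `C` is a subset of the square of side `n` with index `u` that meets each of its rows and columns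
in at least `R` points. -/
structure IsSpread (n R : ℕ) (u : ℕ × ℕ) (C : Finset (ℕ × ℕ)) : Prop where
  inBlock : ∀ a ∈ C, InBlock n u a
  le_card : ∀ d i, i / n = coord d u → R ≤ (C.filter fun a => coord d a = i).card

/-- The open edges link a set that meets each row and each column of the square in at least `R`
points. -/
def GoodBlock (n R : ℕ) (u : ℕ × ℕ) (η : Set GridEdge) : Prop :=
  ∃ C, IsSpread n R u C ∧ Linked η C

theorem goodBlock_one (u : ℕ × ℕ) (η : Set GridEdge) : GoodBlock 1 1 u η := by
  refine ⟨{u}, ⟨by simp [InBlock], fun d i hi => ?_⟩, fun σ _ a ha b hb => ?_⟩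
  · rw [Nat.div_one] at hi
    simp [hi, Finset.filter_singleton]
  · rw [Finset.mem_singleton.mp ha, Finset.mem_singleton.mp hb]

theorem IsSpread.le_card_range {n R : ℕ} (hn : 0 < n) {v : ℕ × ℕ} {C : Finset (ℕ × ℕ)}
    (hC : IsSpread n R v C) {d : Bool} {i : ℕ} (hi : i / n = coord d v) :
    R ≤ ((Finset.range n).filter fun t => point d i (coord (!d) v * n + t) ∈ C).card := by
  have hpoint : ∀ a ∈ C, coord d a = i → point d i (coord (!d) v * n + coord (!d) a % n) = a := by
    intro a ha hai
    rw [← (hC.inBlock a ha).coord_div, Nat.div_add_mod', ← hai, point_coord]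
  refine (hC.le_card d i hi).trans
    (Finset.card_le_card_of_injOn (fun a => coord (!d) a % n) ?_ ?_)
  · intro a ha
    simp only [Finset.coe_filter, Set.mem_ofPred_eq, Finset.mem_range] at ha ⊢
    exact ⟨Nat.mod_lt _ hn, by rw [hpoint a ha.1 ha.2]; exact ha.1⟩
  · intro a ha b hb hab
    simp only [Finset.coe_filter, Set.mem_ofPred_eq] at ha hb
    rw [← hpoint a ha.1 ha.2, ← hpoint b hb.1 hb.2]
    exact congrArg (fun t => point d i (coord (!d) v * n + t)) hab

theorem IsSpread.exists_face {n R : ℕ} (hn : 0 < n) {v : ℕ × ℕ} {d : Bool}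
    {C C' : Finset (ℕ × ℕ)} (hC : IsSpread n R v C) (hC' : IsSpread n R (step v d) C') :
    ∃ T ⊆ Finset.range n, 2 * R ≤ n + T.card ∧
      ∀ t ∈ T, (face n v d t).1 ∈ C ∧ step (face n v d t).1 (face n v d t).2 ∈ C' := by
  have hcard : R ≤ ((Finset.range n).filter fun t => (face n v d t).1 ∈ C).card :=
    hC.le_card_range hn (mul_add_div_self (Nat.sub_lt hn one_pos))
  have hcard' := hC'.le_card_range hn (d := d) (Nat.mul_div_cancel _ hn)
  simp only [← step_face hn] at hcard'
  refine ⟨(Finset.range n).filter fun t => (face n v d t).1 ∈ C ∧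
    step (face n v d t).1 (face n v d t).2 ∈ C', Finset.filter_subset _ _, ?_,
    fun t ht => (Finset.mem_filter.mp ht).2⟩
  have hinter := Finset.card_union_add_card_inter
    ((Finset.range n).filter fun t => (face n v d t).1 ∈ C)
    ((Finset.range n).filter fun t => step (face n v d t).1 (face n v d t).2 ∈ C')
  have hunion := Finset.card_le_card (Finset.union_subset
    (Finset.filter_subset (fun t => (face n v d t).1 ∈ C) (Finset.range n))
    (Finset.filter_subset (fun t => step (face n v d t).1 (face n v d t).2 ∈ C') _))
  rw [← Finset.filter_and] at hinter
  rw [Finset.card_range] at hunion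
  omega

/-- The points of the square of side `m` with index `u`. -/
def block (m : ℕ) (u : ℕ × ℕ) : Finset (ℕ × ℕ) :=
  Finset.Ico (u.1 * m) (u.1 * m + m) ×ˢ Finset.Ico (u.2 * m) (u.2 * m + m)

theorem mem_Ico_iff_div_eq {m : ℕ} (hm : 0 < m) {x w : ℕ} :
    x ∈ Finset.Ico (w * m) (w * m + m) ↔ x / m = w := by
  rw [Finset.mem_Ico, Nat.div_eq_iff hm]
  omega

theorem mem_block {m : ℕ} (hm : 0 < m) {u v : ℕ × ℕ} : v ∈ block m u ↔ InBlock m u v := by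
  rw [block, Finset.mem_product, mem_Ico_iff_div_eq hm, mem_Ico_iff_div_eq hm, InBlock]

theorem card_block (m : ℕ) (u : ℕ × ℕ) : (block m u).card = m ^ 2 := by
  simp [block, sq]

theorem pred_card_mul_le_card {ι α : Type*} [DecidableEq ι] {I : Finset ι} (x₀ : ι)
    {S : ι → Finset α} {C : Finset α} {R : ℕ} (hS : ∀ x ∈ I.erase x₀, S x ⊆ C ∧ R ≤ (S x).card)
    (hdisj : ∀ x ∈ I.erase x₀, ∀ y ∈ I.erase x₀, x ≠ y → Disjoint (S x) (S y)) :
    (I.card - 1) * R ≤ C.card :=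
  calc (I.card - 1) * R ≤ (I.erase x₀).card * R :=
        Nat.mul_le_mul_right _ Finset.pred_card_le_card_erase
    _ ≤ ∑ x ∈ I.erase x₀, (S x).card := by
        rw [← smul_eq_mul]
        exact Finset.card_nsmul_le_sum _ _ _ fun x hx => (hS x hx).2
    _ = ((I.erase x₀).biUnion S).card := (Finset.card_biUnion hdisj).symm
    _ ≤ C.card := Finset.card_le_card (Finset.biUnion_subset.mpr fun x hx => (hS x hx).1)

theorem isSpread_biUnion {n R m : ℕ} (hm : 0 < m) {u v₀ : ℕ × ℕ} {C : ℕ × ℕ → Finset (ℕ × ℕ)}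
    (hC : ∀ v ∈ (block m u).erase v₀, IsSpread n R v (C v)) :
    IsSpread (m * n) ((m - 1) * R) u (((block m u).erase v₀).biUnion C) := by
  constructor
  · intro a ha
    obtain ⟨v, hv, hav⟩ := Finset.mem_biUnion.mp ha
    exact ((mem_block hm).mp (Finset.mem_of_mem_erase hv)).mul ((hC v hv).inBlock a hav)
  · intro d i hi
    rw [mul_comm, ← Nat.div_div_eq_div_mul] at hi
    have hline : ∀ x ∈ (Finset.Ico (coord (!d) u * m) (coord (!d) u * m + m)).erase
        (coord (!d) v₀), point d (i / n) x ∈ (block m u).erase v₀ := by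
      intro x hx
      rw [Finset.mem_erase, mem_Ico_iff_div_eq hm] at hx
      exact Finset.mem_erase.mpr ⟨fun h => hx.1 (by rw [← h, coord_not_point]),
        (mem_block hm).mpr (inBlock_point hi hx.2)⟩
    have hcard := pred_card_mul_le_card (R := R) (coord (!d) v₀)
      (C := (((block m u).erase v₀).biUnion C).filter fun a => coord d a = i)
      (S := fun x => (C (point d (i / n) x)).filter fun a => coord d a = i)
      (fun x hx => ⟨Finset.filter_subset_filter _ (Finset.subset_biUnion_of_mem C (hline x hx)),
        (hC _ (hline x hx)).le_card d i (coord_point d _ _).symm⟩) ?_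
    · rwa [Nat.card_Ico, Nat.add_sub_cancel_left] at hcard
    · intro x hx y hy hxy
      refine Finset.disjoint_left.mpr fun a ha ha' => hxy ?_
      have heq := ((hC _ (hline x hx)).inBlock a (Finset.mem_of_mem_filter a ha)).unique
        ((hC _ (hline y hy)).inBlock a (Finset.mem_of_mem_filter a ha'))
      simpa only [coord_not_point] using congrArg (coord (!d)) heq

theorem linked_biUnion {n R m : ℕ} (hn : 0 < n) (hR : 3 * n ≤ 4 * R) (hm : 2 ≤ m) {u v₀ : ℕ × ℕ}
    {η : Set GridEdge} {C : ℕ × ℕ → Finset (ℕ × ℕ)}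
    (hC : ∀ v ∈ (block m u).erase v₀, IsSpread n R v (C v) ∧ Linked η (C v))
    (hface : ∀ v d, InBlock m u v → InBlock m u (step v d) → ∀ T ⊆ Finset.range n,
      n ≤ 2 * T.card → ∃ t ∈ T, face n v d t ∈ η) :
    Linked η (((block m u).erase v₀).biUnion C) := by
  intro σ hσ a ha b hb
  have hspin : ∀ v ∈ (block m u).erase v₀, ∃ s, ∀ a ∈ C v, σ a = s := by
    intro v hv
    rcases (C v).eq_empty_or_nonempty with hempty | ⟨a, ha⟩
    · exact ⟨1, by simp [hempty]⟩
    · exact ⟨σ a, fun b hb => (hC v hv).2 σ hσ b hb a ha⟩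
  choose! g hg using hspin
  have hmem : ∀ v, v ∈ (block m u).erase v₀ ↔ v ≠ v₀ ∧ InBlock m u v := fun v => by
    rw [Finset.mem_erase, mem_block (by omega)]
  have hstep : ∀ v d, InBlock m u v → InBlock m u (step v d) → v ≠ v₀ → step v d ≠ v₀ →
      g v = g (step v d) := by
    intro v d hv hvd hv₀ hvd₀
    have hvB := (hmem v).mpr ⟨hv₀, hv⟩
    have hvdB := (hmem _).mpr ⟨hvd₀, hvd⟩
    obtain ⟨T, hT, hcard, hTC⟩ := (hC v hvB).1.exists_face hn (hC _ hvdB).1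
    obtain ⟨t, ht, htη⟩ := hface v d hv hvd T hT (by omega)
    rw [← hg v hvB _ (hTC t ht).1, ← hg _ hvdB _ (hTC t ht).2]
    exact hσ _ htη
  obtain ⟨v, hv, hav⟩ := Finset.mem_biUnion.mp ha
  obtain ⟨w, hw, hbw⟩ := Finset.mem_biUnion.mp hb
  rw [hg v hv a hav, hg w hw b hbw]
  exact eq_of_inBlock_of_ne hm hstep ((hmem v).mp hv).2 ((hmem w).mp hw).2 ((hmem v).mp hv).1
    ((hmem w).mp hw).1

theorem goodBlock_mul {n R m : ℕ} (hn : 0 < n) (hR : 3 * n ≤ 4 * R) (hm : 2 ≤ m) {u : ℕ × ℕ}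
    {η : Set GridEdge} (v₀ : ℕ × ℕ) (hgood : ∀ v, InBlock m u v → v ≠ v₀ → GoodBlock n R v η)
    (hface : ∀ v d, InBlock m u v → InBlock m u (step v d) → ∀ T ⊆ Finset.range n,
      n ≤ 2 * T.card → ∃ t ∈ T, face n v d t ∈ η) :
    GoodBlock (m * n) ((m - 1) * R) u η := by
  have hm0 : 0 < m := by omega
  have hgood' : ∀ v ∈ (block m u).erase v₀, ∃ C, IsSpread n R v C ∧ Linked η C := fun v hv =>
    hgood v ((mem_block hm0).mp (Finset.mem_of_mem_erase hv)) (Finset.ne_of_mem_erase hv)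
  choose! C hC using hgood'
  exact ⟨_, isSpread_biUnion hm0 fun v hv => (hC v hv).1, linked_biUnion hn hR hm hC hface⟩

end Percolation

section Renormalization

theorem cover_two_bad {n R m : ℕ} {q p : ℝ} (hm : 0 < m) (hq : 0 ≤ q) (hp : 0 ≤ p)
    (h : ∀ v, Cover q (EdgeIn n v) (fun η => ¬ GoodBlock n R v η) p) (u : ℕ × ℕ) :
    Cover q (EdgeIn (m * n) u)
      (fun η => ∃ w ∈ (block m u).offDiag, ¬ GoodBlock n R w.1 η ∧ ¬ GoodBlock n R w.2 η)
      (m ^ 4 * p ^ 2) := by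
  refine (Cover.exists_mem (p := fun _ => p * p) hq _ fun w hw => ?_).mono (fun _ h => h)
    (fun _ h => h) ?_
  · rw [Finset.mem_offDiag, mem_block hm, mem_block hm] at hw
    refine (Cover.and hq hp (fun e he he' => hw.2.2 (he.1.unique he'.1)) (h w.1) (h w.2)).mono ?_
      (fun _ h => h) le_rfl
    rintro e (he | he)
    exacts [he.mul hw.1, he.mul hw.2.1]
  · have hcard : (block m u).offDiag.card ≤ m ^ 4 := by
      rw [Finset.offDiag_card, card_block]
      exact (Nat.sub_le _ _).trans_eq (by ring)
    rw [Finset.sum_const, nsmul_eq_mul, ← sq]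
    gcongr
    exact_mod_cast hcard

theorem cover_closed_face {n m : ℕ} {ρ : ℝ} (hn : 0 < n) (hm : 0 < m) (hρ : 0 ≤ ρ) (hρ1 : ρ ≤ 1)
    (u : ℕ × ℕ) :
    Cover (ρ ^ 2) (EdgeIn (m * n) u)
      (fun η => ∃ w ∈ (block m u ×ˢ Finset.univ).filter fun w => step w.1 w.2 ∈ block m u,
        ∃ T ∈ (Finset.range n).powerset.filter fun T => n ≤ 2 * T.card,
          ∀ e ∈ T.image (face n w.1 w.2), e ∉ η)
      (2 * m ^ 2 * (2 * ρ) ^ n) := by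
  refine (Cover.exists_mem (p := fun _ => ∑ _T ∈ _, ρ ^ n) (sq_nonneg ρ) _ fun w hw =>
    Cover.exists_mem (sq_nonneg ρ) _ fun T hT => ?_).mono (fun _ h => h) (fun _ h => h) ?_
  · rw [Finset.mem_filter, Finset.mem_product, mem_block hm, mem_block hm] at hw
    rw [Finset.mem_filter, Finset.mem_powerset] at hT
    refine (Cover.closed (T.image (face n w.1 w.2)) ?_).mono (fun _ h => h) (fun _ h => h) ?_
    · intro e he
      obtain ⟨t, ht, rfl⟩ := Finset.mem_image.mp he
      exact edgeIn_face hn hw.1.1 hw.2 (Finset.mem_range.mp (hT.1 ht))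
    · rw [Finset.card_image_of_injective _ (face_injective _ _), ← pow_mul]
      exact pow_le_pow_of_le_one hρ hρ1 hT.2
  · have hfaces : ((block m u ×ˢ (Finset.univ : Finset Bool)).filter
        fun w => step w.1 w.2 ∈ block m u).card ≤ 2 * m ^ 2 := by
      refine (Finset.card_filter_le _ _).trans ?_
      simp [Finset.card_product, card_block, mul_comm]
    have hsets : ((Finset.range n).powerset.filter fun T => n ≤ 2 * T.card).card ≤ 2 ^ n := by
      refine (Finset.card_filter_le _ _).trans ?_
      rw [Finset.card_powerset, Finset.card_range]
    simp only [Finset.sum_const, nsmul_eq_mul]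
    rw [mul_pow]
    gcongr <;> exact_mod_cast ‹_›

theorem cover_block_mul {n R m : ℕ} {ρ p : ℝ} (hn : 0 < n) (hR : 3 * n ≤ 4 * R) (hm : 2 ≤ m)
    (hρ : 0 ≤ ρ) (hρ1 : ρ ≤ 1) (hp : 0 ≤ p)
    (h : ∀ v, Cover (ρ ^ 2) (EdgeIn n v) (fun η => ¬ GoodBlock n R v η) p) (u : ℕ × ℕ) :
    Cover (ρ ^ 2) (EdgeIn (m * n) u) (fun η => ¬ GoodBlock (m * n) ((m - 1) * R) u η)
      (m ^ 4 * p ^ 2 + 2 * m ^ 2 * (2 * ρ) ^ n) := by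
  have hm0 : 0 < m := by omega
  refine (Cover.or (sq_nonneg ρ) (cover_two_bad hm0 (sq_nonneg ρ) hp h u)
    (cover_closed_face hn hm0 hρ hρ1 u)).mono (fun _ h => h) (fun η hη => ?_) le_rfl
  by_contra hcon
  rw [not_or] at hcon
  obtain ⟨hbad, hclosed⟩ := hcon
  push Not at hbad hclosed
  obtain ⟨v₀, hv₀⟩ : ∃ v₀, ∀ v, InBlock m u v → v ≠ v₀ → GoodBlock n R v η := by
    by_cases hall : ∃ v₀ ∈ block m u, ¬ GoodBlock n R v₀ η
    · obtain ⟨v₀, hv₀, hbad₀⟩ := hall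
      exact ⟨v₀, fun v hv hne => hbad (v₀, v)
        (Finset.mem_offDiag.mpr ⟨hv₀, (mem_block hm0).mpr hv, hne.symm⟩) hbad₀⟩
    · push Not at hall
      exact ⟨u, fun v hv _ => hall v ((mem_block hm0).mpr hv)⟩
  refine hη (goodBlock_mul hn hR hm v₀ hv₀ fun v d hv hvd T hT hcard => ?_)
  obtain ⟨e, he, heη⟩ := hclosed (v, d)
    (by simp [mem_block hm0, hv, hvd]) T (by simp only [Finset.mem_filter, Finset.mem_powerset, hT,
      hcard, and_self])
  obtain ⟨t, ht, rfl⟩ := Finset.mem_image.mp he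
  exact ⟨t, ht, heη⟩

/-- Side lengths of the squares in the renormalization: the squares of level `k + 1` consist of
`2 ^ (k + 5) × 2 ^ (k + 5)` squares of level `k`. -/
def side : ℕ → ℕ
  | 0 => 1
  | k + 1 => 2 ^ (k + 5) * side k

/-- Number of points in each row and column that a good square of level `k` is required to link. -/
def spread : ℕ → ℕ
  | 0 => 1
  | k + 1 => (2 ^ (k + 5) - 1) * spread k

theorem succ_le_side (k : ℕ) : k + 1 ≤ side k := by
  induction k with
  | zero => simp [side]
  | succ k ih =>
    have : 2 ^ 1 ≤ 2 ^ (k + 5) := Nat.pow_le_pow_right two_pos (by omega)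
    rw [side]
    nlinarith

theorem side_pos (k : ℕ) : 0 < side k := lt_of_lt_of_le (Nat.succ_pos k) (succ_le_side k)

theorem side_mul_le_spread (k : ℕ) : (15 / 16 + (1 / 2 : ℝ) ^ (k + 4)) * side k ≤ spread k := by
  induction k with
  | zero => norm_num [side, spread]
  | succ k ih =>
    set x := (1 / 2 : ℝ) ^ (k + 5) with hx
    set N := (2 : ℝ) ^ (k + 5) with hN
    have hxN : x * N = 1 := by rw [hx, hN, ← mul_pow]; norm_num
    have hx' : (1 / 2 : ℝ) ^ (k + 4) = 2 * x := by rw [hx, pow_succ _ (k + 4)]; ring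
    have hx_le : 2 * x ≤ 1 / 16 := by
      rw [← hx']
      exact (pow_le_pow_of_le_one (by norm_num) (by norm_num) (by omega : 4 ≤ k + 4)).trans
        (by norm_num)
    have hN1 : 1 ≤ N := one_le_pow₀ one_le_two
    have hcast : (((2 ^ (k + 5) - 1 : ℕ)) : ℝ) = N - 1 := by
      push_cast [Nat.cast_sub (Nat.one_le_two_pow (n := k + 5))]
      rfl
    rw [hx'] at ih
    rw [side, spread, Nat.cast_mul, Nat.cast_mul, hcast, Nat.cast_pow, Nat.cast_ofNat]
    calc (15 / 16 + x) * (N * side k)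
        = (N - 1) * ((15 / 16 + 2 * x) * side k)
          - (x * N - (15 / 16 + 2 * x)) * side k := by ring
      _ ≤ (N - 1) * ((15 / 16 + 2 * x) * side k) :=
          sub_le_self _ (mul_nonneg (by linarith) (Nat.cast_nonneg _))
      _ ≤ (N - 1) * spread k := mul_le_mul_of_nonneg_left ih (by linarith)

theorem side_le_spread (k : ℕ) : 15 * side k ≤ 16 * spread k := by
  have hle := side_mul_le_spread k
  have hpos : (0 : ℝ) ≤ (1 / 2 : ℝ) ^ (k + 4) * side k := by positivity
  have : (15 : ℝ) * side k ≤ 16 * spread k := by linarith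
  exact_mod_cast this

theorem renormalization_bound {ρ : ℝ} (hρ : 0 ≤ ρ) (hρ' : 2 * ρ ≤ (1 / 2) ^ 41) (k : ℕ) :
    ((2 ^ (k + 5) : ℕ) : ℝ) ^ 4 * ((1 / 2) ^ (4 * k + 25)) ^ 2
      + 2 * ((2 ^ (k + 5) : ℕ) : ℝ) ^ 2 * (2 * ρ) ^ side k ≤ (1 / 2) ^ (4 * (k + 1) + 25) := by
  set y : ℝ := (1 / 2) ^ k with hy
  set x : ℝ := 2 ^ k with hx
  have hxy : x * y = 1 := by rw [hx, hy, ← mul_pow]; norm_num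
  have hy0 : 0 < y := by positivity
  have hy1 : y ≤ 1 := pow_le_one₀ (by norm_num) (by norm_num)
  have hpow : ∀ a b, ((1 : ℝ) / 2) ^ (a * k + b) = y ^ a * (1 / 2) ^ b := fun a b => by
    rw [pow_add, mul_comm a k, pow_mul]
  have hside : (2 * ρ) ^ side k ≤ y ^ 41 * (1 / 2) ^ 41 :=
    calc (2 * ρ) ^ side k ≤ ((1 / 2 : ℝ) ^ 41) ^ side k := pow_le_pow_left₀ (by linarith) hρ' _
      _ ≤ ((1 / 2 : ℝ) ^ 41) ^ (k + 1) :=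
          pow_le_pow_of_le_one (by positivity) (pow_le_one₀ (by norm_num) (by norm_num))
            (succ_le_side k)
      _ = y ^ 41 * (1 / 2) ^ 41 := by rw [← pow_mul, mul_add, mul_one, hpow]
  have hm : ((2 ^ (k + 5) : ℕ) : ℝ) = x * 32 := by
    rw [hx]
    push_cast
    rw [pow_add]
    norm_num
  rw [hm, hpow, show 4 * (k + 1) + 25 = 4 * k + 29 by ring, hpow]
  calc (x * 32) ^ 4 * (y ^ 4 * (1 / 2) ^ 25) ^ 2 + 2 * (x * 32) ^ 2 * (2 * ρ) ^ side k
      ≤ (x * 32) ^ 4 * (y ^ 4 * (1 / 2) ^ 25) ^ 2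
        + 2 * (x * 32) ^ 2 * (y ^ 41 * (1 / 2) ^ 41) := by gcongr
    _ = y ^ 4 * (1 / 2) ^ 30 * (x * y) ^ 4 + y ^ 4 * (1 / 2) ^ 30 * (x * y) ^ 2 * y ^ 35 := by
        ring
    _ ≤ y ^ 4 * (1 / 2) ^ 30 + y ^ 4 * (1 / 2) ^ 30 := by
        rw [hxy, one_pow, one_pow, mul_one]
        exact add_le_add_right
          (mul_le_of_le_one_right (by positivity) (pow_le_one₀ hy0.le hy1)) _
    _ = y ^ 4 * (1 / 2) ^ 29 := by ring

theorem cover_not_goodBlock {ρ : ℝ} (hρ : 0 ≤ ρ) (hρ' : 2 * ρ ≤ (1 / 2) ^ 41) (k : ℕ)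
    (u : ℕ × ℕ) :
    Cover (ρ ^ 2) (EdgeIn (side k) u) (fun η => ¬ GoodBlock (side k) (spread k) u η)
      ((1 / 2) ^ (4 * k + 25)) := by
  induction k generalizing u with
  | zero =>
    exact (Cover.of_false fun η => not_not.mpr (goodBlock_one u η)).mono (fun _ h => h)
      (fun _ h => h) (by positivity)
  | succ k ih =>
    have hR : 3 * side k ≤ 4 * spread k := by
      have := side_le_spread k
      omega
    have hm : 2 ^ 1 ≤ 2 ^ (k + 5) := Nat.pow_le_pow_right two_pos (by omega)
    have hρ1 : ρ ≤ 1 := by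
      have : ((1 : ℝ) / 2) ^ 41 ≤ 1 := pow_le_one₀ (by norm_num) (by norm_num)
      linarith
    exact (cover_block_mul (side_pos k) hR hm hρ hρ1 (by positivity) ih u).mono (fun _ h => h)
      (fun _ h => h) (renormalization_bound hρ hρ' k)

end Renormalization

/-! ### Double blocks made of two squares -/

section DoubleBlock

/-- The point lies in one of the two adjacent squares of side `n`. -/
def InDouble (n : ℕ) (a : ℕ × ℕ) : Prop := InBlock n (0, 0) a ∨ InBlock n (1, 0) a

/-- Both ends of the edge lie in the two adjacent squares of side `n`. -/
def EdgeInDouble (n : ℕ) (g : GridEdge) : Prop := InDouble n g.1 ∧ InDouble n (step g.1 g.2)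

/-- The edge lies inside one of the two adjacent squares of side `n`. -/
def StrongEdge (n : ℕ) (g : GridEdge) : Prop := EdgeIn n (0, 0) g ∨ EdgeIn n (1, 0) g

/-- The `t`-th edge between the two adjacent squares of side `n`. -/
def linkEdge (n t : ℕ) : GridEdge := face n (0, 0) false t

/-- The sign of the coupling of the `t`-th link. -/
def linkSign (n t : ℕ) : ℝ := if 2 * t < n then 1 else -1

theorem linkSign_eq (n t : ℕ) : linkSign n t = 1 ∨ linkSign n t = -1 := by
  unfold linkSign
  split_ifs <;> simp

theorem sum_linkSign {n : ℕ} (hn : Even n) : ∑ t : Fin n, linkSign n t = 0 := by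
  obtain ⟨j, rfl⟩ := hn
  have hpos : ∀ t ∈ Finset.range j, linkSign (j + j) t = 1 := fun t ht =>
    if_pos (by have := Finset.mem_range.mp ht; omega)
  have hneg : ∀ t ∈ Finset.range j, linkSign (j + j) (j + t) = -1 := fun t _ =>
    if_neg (by omega)
  rw [Fin.sum_univ_eq_sum_range (fun t => linkSign (j + j) t), Finset.sum_range_add,
    Finset.sum_congr rfl hpos, Finset.sum_congr rfl hneg]
  simp

theorem StrongEdge.edgeInDouble {n : ℕ} {g : GridEdge} (h : StrongEdge n g) :
    EdgeInDouble n g :=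
  ⟨h.imp And.left And.left, h.imp And.right And.right⟩

theorem linkEdge_fst {n t : ℕ} (ht : t < n) : InBlock n (0, 0) (linkEdge n t).1 :=
  face_fst (by omega) _ _ ht

theorem linkEdge_snd {n t : ℕ} (ht : t < n) :
    InBlock n (1, 0) (step (linkEdge n t).1 (linkEdge n t).2) :=
  face_snd (by omega) (0, 0) false ht

theorem edgeInDouble_linkEdge {n t : ℕ} (ht : t < n) : EdgeInDouble n (linkEdge n t) :=
  ⟨Or.inl (linkEdge_fst ht), Or.inr (linkEdge_snd ht)⟩

theorem not_inBlock_zero_one {n : ℕ} {a : ℕ × ℕ} (ha : InBlock n (0, 0) a) :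
    ¬ InBlock n (1, 0) a := fun ha' => by simpa using ha.unique ha'

theorem not_strongEdge_linkEdge {n t : ℕ} (ht : t < n) : ¬ StrongEdge n (linkEdge n t) := by
  rintro (h | h)
  · exact not_inBlock_zero_one h.2 (linkEdge_snd ht)
  · exact not_inBlock_zero_one (linkEdge_fst ht) h.1

theorem gridEdge_eq {g g' : GridEdge}
    (h : (g.1 = g'.1 ∧ step g.1 g.2 = step g'.1 g'.2) ∨
      (g.1 = step g'.1 g'.2 ∧ step g.1 g.2 = g'.1)) : g = g' := by
  obtain ⟨⟨x, y⟩, d⟩ := g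
  obtain ⟨⟨x', y'⟩, d'⟩ := g'
  cases d <;> cases d' <;> simp [step] at h ⊢ <;> omega

/-- A copy of the two squares in the graph `G`: the point `a` sits at the vertex `P a` and the grid
edge `g` is the edge `edge g`. Values outside the two squares are irrelevant. -/
structure DoubleBlock {V : Type*} (G : SimpleGraph V) (n : ℕ) where
  P : ℕ × ℕ → V
  edge : GridEdge → G.edgeSet
  inj : ∀ a b, InDouble n a → InDouble n b → P a = P b → a = b
  edge_eq : ∀ g, EdgeInDouble n g → (edge g : Sym2 V) = s(P g.1, P (step g.1 g.2))

namespace DoubleBlock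

section Geometry

variable {V : Type*} {G : SimpleGraph V} {n : ℕ} (B : DoubleBlock G n)

theorem edge_inj {g g' : GridEdge} (hg : EdgeInDouble n g) (hg' : EdgeInDouble n g')
    (h : B.edge g = B.edge g') : g = g' := by
  have h' := congrArg Subtype.val h
  rw [B.edge_eq g hg, B.edge_eq g' hg', Sym2.eq_iff] at h'
  exact gridEdge_eq <| h'.imp
    (fun h => ⟨B.inj _ _ hg.1 hg'.1 h.1, B.inj _ _ hg.2 hg'.2 h.2⟩)
    (fun h => ⟨B.inj _ _ hg.1 hg'.2 h.1, B.inj _ _ hg.2 hg'.1 h.2⟩)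

/-- The set of vertices of the right square. -/
def rightSquare : Set V := {x | ∃ a, InBlock n (1, 0) a ∧ B.P a = x}

/-- The edges with an end in one of the squares. -/
def touching : Set G.edgeSet := {e | ∃ a, InDouble n a ∧ B.P a ∈ (e : Sym2 V)}

/-- The edges that touch the squares without belonging to the construction. -/
def IsWeak (e : G.edgeSet) : Prop :=
  (∀ g, StrongEdge n g → e ≠ B.edge g) ∧ (∀ t < n, e ≠ B.edge (linkEdge n t)) ∧ e ∈ B.touching

/-- `y` is a suitable value of `β * J e` for the double block to be frustrated. -/
structure Fits (h ε : ℝ) (e : G.edgeSet) (y : ℝ) : Prop where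
  strong : ∀ g, StrongEdge n g → e = B.edge g → 50 < y
  link : ∀ t < n, e = B.edge (linkEdge n t) → |y - linkSign n t * h| ≤ h / 100
  weak : B.IsWeak e → |y| ≤ ε

variable {B}

theorem edge_mem_touching {g : GridEdge} (hg : EdgeInDouble n g) : B.edge g ∈ B.touching :=
  ⟨g.1, hg.1, by rw [B.edge_eq g hg]; exact Sym2.mem_mk_left _ _⟩

theorem edge_ne_edge_linkEdge {g : GridEdge} (hg : StrongEdge n g) {t : ℕ} (ht : t < n) :
    B.edge g ≠ B.edge (linkEdge n t) := fun h =>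
  not_strongEdge_linkEdge ht (B.edge_inj hg.edgeInDouble (edgeInDouble_linkEdge ht) h ▸ hg)

theorem edge_linkEdge_inj {s t : ℕ} (hs : s < n) (ht : t < n)
    (h : B.edge (linkEdge n s) = B.edge (linkEdge n t)) : s = t :=
  face_injective _ _ (B.edge_inj (edgeInDouble_linkEdge hs) (edgeInDouble_linkEdge ht) h)

theorem fits_strong {g : GridEdge} (hg : StrongEdge n g) {h ε y : ℝ} (hy : 50 < y) :
    B.Fits h ε (B.edge g) y where
  strong _ _ _ := hy
  link _ ht heq := absurd heq (edge_ne_edge_linkEdge hg ht)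
  weak hweak := absurd rfl (hweak.1 g hg)

theorem fits_link {t : ℕ} (ht : t < n) {h ε y : ℝ} (hy : |y - linkSign n t * h| ≤ h / 100) :
    B.Fits h ε (B.edge (linkEdge n t)) y where
  strong _ hg heq := absurd heq.symm (edge_ne_edge_linkEdge hg ht)
  link s hs heq := by rwa [← edge_linkEdge_inj ht hs heq]
  weak hweak := absurd rfl (hweak.2.1 t ht)

theorem fits_weak {e : G.edgeSet} (hstrong : ∀ g, StrongEdge n g → e ≠ B.edge g)
    (hlink : ∀ t < n, e ≠ B.edge (linkEdge n t)) {h ε y : ℝ} (hy : |y| ≤ ε) : B.Fits h ε e y where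
  strong g hg heq := absurd heq (hstrong g hg)
  link t ht heq := absurd heq (hlink t ht)
  weak _ := hy

theorem notMem_rightSquare {a : ℕ × ℕ} (ha : InBlock n (0, 0) a) : B.P a ∉ B.rightSquare := by
  rintro ⟨b, hb, hab⟩
  obtain rfl := B.inj b a (Or.inr hb) (Or.inl ha) hab
  exact not_inBlock_zero_one ha hb

theorem mem_edge {g : GridEdge} (hg : EdgeInDouble n g) {x : V} :
    x ∈ (B.edge g : Sym2 V) ↔ x = B.P g.1 ∨ x = B.P (step g.1 g.2) := by
  rw [B.edge_eq g hg, Sym2.mem_iff]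

theorem mem_rightSquare_of_mem_edge {g : GridEdge} (hg : StrongEdge n g) {x y : V}
    (hx : x ∈ (B.edge g : Sym2 V)) (hy : y ∈ (B.edge g : Sym2 V)) (hxr : x ∈ B.rightSquare) :
    y ∈ B.rightSquare := by
  rw [mem_edge hg.edgeInDouble] at hx hy
  rcases hg with hg | hg
  · rcases hx with rfl | rfl
    · exact absurd hxr (notMem_rightSquare hg.1)
    · exact absurd hxr (notMem_rightSquare hg.2)
  · rcases hy with rfl | rfl
    · exact ⟨_, hg.1, rfl⟩
    · exact ⟨_, hg.2, rfl⟩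

end Geometry

section Comap

variable {V V' : Type*} {G : SimpleGraph V} {G' : SimpleGraph V'} {n : ℕ}

/-- The embedding `f` maps the double block `B` to `B'`. -/
def IsComap (f : G ↪g G') (B : DoubleBlock G n) (B' : DoubleBlock G' n) : Prop :=
  ∀ a, InDouble n a → f (B.P a) = B'.P a

theorem exists_isComap (f : G ↪g G') (B' : DoubleBlock G' n) (hn : 0 < n)
    (hf : ∀ a, InDouble n a → B'.P a ∈ Set.range f) : ∃ B : DoubleBlock G n, IsComap f B B' := by
  have hlink := edgeInDouble_linkEdge hn
  have : Nonempty V := ⟨(hf _ hlink.1).choose⟩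
  choose! P hP using hf
  have hadj : ∀ g, EdgeInDouble n g →
      ∃ e : G.edgeSet, (e : Sym2 V) = s(P g.1, P (step g.1 g.2)) := fun g hg => by
    refine ⟨⟨s(P g.1, P (step g.1 g.2)), ?_⟩, rfl⟩
    rw [SimpleGraph.mem_edgeSet, ← f.map_adj_iff, hP _ hg.1, hP _ hg.2, ← SimpleGraph.mem_edgeSet,
      ← B'.edge_eq g hg]
    exact (B'.edge g).2
  have : Nonempty G.edgeSet := ⟨(hadj _ hlink).choose⟩
  choose! edge hedge using hadj
  exact ⟨⟨P, edge, fun a b ha hb hab => B'.inj a b ha hb (by rw [← hP a ha, hab, hP b hb]), hedge⟩,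
    hP⟩

variable {f : G ↪g G'} {B : DoubleBlock G n} {B' : DoubleBlock G' n}

theorem IsComap.map_edge (hf : IsComap f B B') {g : GridEdge} (hg : EdgeInDouble n g) :
    f.mapEdgeSet (B.edge g) = B'.edge g := by
  refine Subtype.ext ?_
  rw [B'.edge_eq g hg, ← hf _ hg.1, ← hf _ hg.2]
  exact congrArg (Sym2.map f) (B.edge_eq g hg)

theorem IsComap.map_mem_touching (hf : IsComap f B B') {e : G.edgeSet} (he : e ∈ B.touching) :
    f.mapEdgeSet e ∈ B'.touching := by
  obtain ⟨a, ha, hae⟩ := he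
  exact ⟨a, ha, Sym2.mem_map.mpr ⟨B.P a, hae, hf a ha⟩⟩

theorem IsComap.ncard_touching_le (hf : IsComap f B B') (hfin : B'.touching.Finite) :
    B.touching.ncard ≤ B'.touching.ncard :=
  Set.ncard_le_ncard_of_injOn f.mapEdgeSet (fun _ he => hf.map_mem_touching he)
    f.mapEdgeSet.injective.injOn hfin

theorem IsComap.fits (hf : IsComap f B B') {h ε : ℝ} {e : G.edgeSet} {y : ℝ}
    (hy : B'.Fits h ε (f.mapEdgeSet e) y) : B.Fits h ε e y where
  strong g hg heq := hy.strong g hg (by rw [heq, hf.map_edge hg.edgeInDouble])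
  link t ht heq := hy.link t ht (by rw [heq, hf.map_edge (edgeInDouble_linkEdge ht)])
  weak hweak := hy.weak
    ⟨fun g hg heq => hweak.1 g hg <| f.mapEdgeSet.injective <| by
        rw [heq, hf.map_edge hg.edgeInDouble],
      fun t ht heq => hweak.2.1 t ht <| f.mapEdgeSet.injective <| by
        rw [heq, hf.map_edge (edgeInDouble_linkEdge ht)],
      hf.map_mem_touching hweak.2.2⟩

end Comap

section Frustrated

variable {V : Type*} [Fintype V] {G : SimpleGraph V} {n : ℕ}

/-- Strongly ferromagnetic couplings inside the two squares, links of strength about `h / β`, half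
of them of each sign, and nearly vanishing couplings on the other edges that touch the squares. -/
structure IsFrustrated (B : DoubleBlock G n) (J : G.edgeSet → ℝ) (β h r : ℝ) : Prop where
  even : Even n
  strong_pos : ∀ g, StrongEdge n g → 0 < J (B.edge g)
  strong_large : ∀ g, StrongEdge n g → 2 * r ≤ Real.exp (2 * (β * J (B.edge g))) - 1
  link_coupling : ∀ t < n, |β * J (B.edge (linkEdge n t)) - linkSign n t * h| ≤ h / 100
  weak_small : ∑ e with B.IsWeak e, β * |J e| ≤ 1

variable {B : DoubleBlock G n} {J : G.edgeSet → ℝ} {β h r : ℝ}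

/-- The gadget formed by a frustrated double block. -/
def IsFrustrated.toGadget (hB : B.IsFrustrated J β h r) : Gadget G J β n h r where
  strong := Finset.univ.filter fun e => ∃ g, StrongEdge n g ∧ B.edge g = e
  weak := Finset.univ.filter B.IsWeak
  link t := B.edge (linkEdge n t)
  left t := B.P (linkEdge n t).1
  right t := B.P (step (linkEdge n t).1 (linkEdge n t).2)
  sign t := linkSign n t
  core := {x | ∃ a, InDouble n a ∧ B.P a = x}
  block := B.rightSquare
  link_injective s t hst := Fin.ext (edge_linkEdge_inj s.2 t.2 hst)
  link_eq t := B.edge_eq _ (edgeInDouble_linkEdge t.2)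
  disjoint_weak := by
    simp only [Finset.mem_filter_univ]
    rintro _ ⟨g, hg, rfl⟩ hweak
    exact hweak.1 g hg rfl
  link_notMem_strong t := by
    simp only [Finset.mem_filter_univ]
    rintro ⟨g, hg, hgt⟩
    exact edge_ne_edge_linkEdge hg t.2 hgt
  link_notMem_weak t ht := ((Finset.mem_filter_univ _).mp ht).2.1 t t.2 rfl
  strong_core := by
    simp only [Finset.mem_filter_univ]
    rintro _ ⟨g, hg, rfl⟩ x hx
    rcases (mem_edge hg.edgeInDouble).mp hx with rfl | rfl
    · exact ⟨_, hg.edgeInDouble.1, rfl⟩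
    · exact ⟨_, hg.edgeInDouble.2, rfl⟩
  strong_block := by
    simp only [Finset.mem_filter_univ]
    rintro _ ⟨g, hg, rfl⟩ x hx y hy
    exact mem_rightSquare_of_mem_edge hg hx hy
  strong_pos := by
    simp only [Finset.mem_filter_univ]
    rintro _ ⟨g, hg, rfl⟩
    exact hB.strong_pos g hg
  strong_large := by
    simp only [Finset.mem_filter_univ]
    rintro _ ⟨g, hg, rfl⟩
    exact hB.strong_large g hg
  other_core := by
    simp only [Finset.mem_filter_univ]
    rintro e hstrong hweak hlink _ hx ⟨a, ha, rfl⟩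
    exact hweak ⟨fun g hg he => hstrong ⟨g, hg, he.symm⟩, fun t ht => hlink ⟨t, ht⟩, a, ha, hx⟩
  block_core := fun _ ⟨a, ha, hx⟩ => ⟨a, Or.inr ha, hx⟩
  left_notMem t := notMem_rightSquare (linkEdge_fst t.2)
  right_mem t := ⟨_, linkEdge_snd t.2, rfl⟩
  sign_eq t := linkSign_eq n t
  sign_sum := sum_linkSign hB.even
  link_coupling t := hB.link_coupling t t.2
  weak_small := hB.weak_small

theorem IsFrustrated.exists_isPinned (hB : B.IsFrustrated J β h r) {R : ℕ} (hn : 0 < n)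
    (hR : 15 * n ≤ 16 * R) {τ : Finset G.edgeSet}
    (hleft : GoodBlock n R (0, 0) {g | StrongEdge n g ∧ B.edge g ∈ τ})
    (hright : GoodBlock n R (1, 0) {g | StrongEdge n g ∧ B.edge g ∈ τ}) :
    ∃ I, hB.toGadget.IsPinned τ I := by
  obtain ⟨C, hC, hlinked⟩ := hleft
  obtain ⟨C', hC', hlinked'⟩ := hright
  obtain ⟨T, hT, hcard, hface⟩ := hC.exists_face (d := false) hn hC'
  have hTn : ∀ t ∈ T, t < n := fun t ht => Finset.mem_range.mp (hT ht)
  refine ⟨T.attachFin hTn, by rw [Finset.card_attachFin]; omega, fun σ hσ => ?_⟩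
  have hspin : ∀ g ∈ {g | StrongEdge n g ∧ B.edge g ∈ τ},
      (σ ∘ B.P) g.1 = (σ ∘ B.P) (step g.1 g.2) := by
    rintro g ⟨hg, hgτ⟩
    have := hσ _ hgτ
    rwa [B.edge_eq g hg.edgeInDouble, edgeSpin_eq_one_iff] at this
  refine ⟨fun i hi j hj => ?_, fun i hi j hj => ?_⟩ <;> rw [Finset.mem_attachFin] at hi hj
  · exact hlinked (σ ∘ B.P) hspin _ (hface _ hi).1 _ (hface _ hj).1
  · exact hlinked' (σ ∘ B.P) hspin _ (hface _ hi).2 _ (hface _ hj).2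

end Frustrated

end DoubleBlock

theorem even_side {k : ℕ} (hk : 0 < k) : Even (side k) := by
  obtain ⟨k, rfl⟩ := Nat.exists_eq_succ_of_ne_zero hk.ne'
  exact Even.mul_right ((even_two).pow_of_ne_zero (by omega)) _

theorem cover_not_goodBlock_pair {ρ : ℝ} (hρ : 0 ≤ ρ) (hρ' : 2 * ρ ≤ (1 / 2) ^ 41) (k : ℕ) :
    Cover (ρ ^ 2) (StrongEdge (side k))
      (fun η => ¬ GoodBlock (side k) (spread k) (0, 0) η ∨
        ¬ GoodBlock (side k) (spread k) (1, 0) η)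
      (2 * (1 / 2) ^ (4 * k + 25)) := by
  rw [two_mul]
  exact ((cover_not_goodBlock hρ hρ' k (0, 0)).mono (fun _ => Or.inl) (fun _ h => h) le_rfl).or
    (sq_nonneg ρ)
    ((cover_not_goodBlock hρ hρ' k (1, 0)).mono (fun _ => Or.inr) (fun _ h => h) le_rfl)

namespace DoubleBlock

variable {V : Type*} [Fintype V] {G : SimpleGraph V} {J : G.edgeSet → ℝ} {β h : ℝ} {k : ℕ}
  {B : DoubleBlock G (side k)}

theorem two_mul_le_exp_sub_one {x : ℝ} (hx : 100 ≤ x) :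
    2 * ((2 : ℝ) ^ 84 - 1) ≤ Real.exp x - 1 := by
  have htwo : (2 : ℝ) ≤ Real.exp 1 := by linarith [Real.add_one_le_exp (1 : ℝ)]
  have : (2 : ℝ) ^ 100 ≤ Real.exp x :=
    calc (2 : ℝ) ^ 100 ≤ Real.exp 1 ^ 100 := pow_le_pow_left₀ (by norm_num) htwo _
      _ = Real.exp 100 := by rw [← Real.exp_nat_mul]; norm_num
      _ ≤ Real.exp x := Real.exp_le_exp.mpr hx
  norm_num at this ⊢
  linarith

theorem IsFrustrated.of_fits {n : ℕ} {B : DoubleBlock G n} (hn : Even n) (hβ : 0 ≤ β) {ε : ℝ}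
    (hε : 0 ≤ ε) (hcard : B.touching.ncard * ε ≤ 1)
    (hJ : ∀ e ∈ B.touching, B.Fits h ε e (β * J e)) : B.IsFrustrated J β h (2 ^ 84 - 1) := by
  have hstrong : ∀ g, StrongEdge n g → 50 < β * J (B.edge g) := fun g hg =>
    (hJ _ (edge_mem_touching hg.edgeInDouble)).strong g hg rfl
  refine ⟨hn, fun g hg => pos_of_mul_pos_right (by linarith [hstrong g hg]) hβ,
    fun g hg => two_mul_le_exp_sub_one (by linarith [hstrong g hg]),
    fun t ht => (hJ _ (edge_mem_touching (edgeInDouble_linkEdge ht))).link t ht rfl, ?_⟩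
  have hweak : (Finset.univ.filter B.IsWeak).card ≤ B.touching.ncard := by
    rw [← Set.ncard_coe_finset]
    exact Set.ncard_le_ncard (fun e he => ((Finset.mem_filter_univ e).mp he).2.2)
  calc ∑ e with B.IsWeak e, β * |J e| ≤ ∑ e with B.IsWeak e, ε := by
        refine Finset.sum_le_sum fun e he => ?_
        have he := (Finset.mem_filter_univ e).mp he
        rw [← abs_of_nonneg hβ, ← abs_mul]
        exact (hJ e he.2.2).weak he
    _ = (Finset.univ.filter B.IsWeak).card * ε := by rw [Finset.sum_const, nsmul_eq_mul]
    _ ≤ B.touching.ncard * ε := by gcongr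
    _ ≤ 1 := hcard

theorem IsFrustrated.unpinnedMass_le (hB : B.IsFrustrated J β h (2 ^ 84 - 1)) (hβ : 0 ≤ β) :
    hB.toGadget.unpinnedMass ≤ 2 * (1 / 2) ^ (4 * k + 25) * hB.toGadget.total := by
  obtain ⟨F, hF, hsum, hcover⟩ :=
    cover_not_goodBlock_pair (ρ := (1 / 2) ^ 42) (by positivity) (by norm_num) k
  have hr : (1 + ((2 : ℝ) ^ 84 - 1))⁻¹ = ((1 / 2) ^ 42) ^ 2 := by norm_num
  refine hB.toGadget.unpinnedMass_le hβ (by norm_num) (F.image (Finset.image B.edge)) ?_ ?_ ?_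
  · refine Finset.forall_mem_image.mpr fun W hW => ?_
    rw [Finset.image_subset_iff]
    exact fun g hg => (Finset.mem_filter_univ _).mpr ⟨g, hF W hW g hg, rfl⟩
  · intro τ _ hhit
    by_contra hpin
    obtain ⟨W, hW, hclosed⟩ := hcover {g | StrongEdge (side k) g ∧ B.edge g ∈ τ} <| by
      by_contra! hgood
      exact hpin (hB.exists_isPinned (side_pos k) (side_le_spread k) hgood.1 hgood.2)
    obtain ⟨e, he, heτ⟩ := hhit _ (Finset.mem_image_of_mem _ hW)
    obtain ⟨g, hg, rfl⟩ := Finset.mem_image.mp he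
    exact hclosed g hg ⟨hF W hW g hg, heτ⟩
  · rw [hr]
    refine (Finset.sum_image_le_of_nonneg
      (f := fun W : Finset G.edgeSet => ((((1 : ℝ) / 2) ^ 42) ^ 2) ^ W.card)
      fun W _ => by positivity).trans (le_of_eq_of_le (Finset.sum_congr rfl fun W hW => ?_) hsum)
    rw [Finset.card_image_of_injOn fun g hg g' hg' => B.edge_inj (hF W hW g hg).edgeInDouble
      (hF W hW g' hg').edgeInDouble]

theorem IsFrustrated.isSlow (hB : B.IsFrustrated J β h (2 ^ 84 - 1)) (hβ : 0 ≤ β) (hh : 0 < h)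
    (hexp : 2 * (1 / 2 : ℝ) ^ (4 * k + 25) ≤ Real.exp (-3 * (h * side k)))
    (hgap : gapBound (h * side k) < 1) :
    IsSlow (swMatrix G J β) (gibbs G J β) (gapBound (h * side k)) := by
  have hmass := hB.unpinnedMass_le hβ
  have htotal := (hB.toGadget.total_pos hβ).le
  have hhalf : 2 * (1 / 2 : ℝ) ^ (4 * k + 25) ≤ 1 / 2 := by
    have : ((1 : ℝ) / 2) ^ (4 * k + 25) ≤ (1 / 2) ^ 2 :=
      pow_le_pow_of_le_one (by norm_num) (by norm_num) (by omega)
    linarith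
  exact hB.toGadget.isSlow hβ hh (side_pos k) (hmass.trans (by gcongr)) (hmass.trans (by gcongr))
    hgap

end DoubleBlock

end DoubleBlock

/-! ### Double blocks in the lattice -/

section Lattice

/-- The coordinate plane through the origin of `ℤ^d`. -/
def planePoint (d : ℕ) (a : ℕ × ℕ) : Fin d → ℤ :=
  fun i => if i.val = 0 then a.1 else if i.val = 1 then a.2 else 0

theorem planePoint_injective {d : ℕ} (hd : 2 ≤ d) : Function.Injective (planePoint d) :=
  fun a b hab => Prod.ext
    (by simpa [planePoint] using congrFun hab ⟨0, by omega⟩)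
    (by simpa [planePoint] using congrFun hab ⟨1, by omega⟩)

theorem latticeGraph_adj_planePoint_step {d : ℕ} (hd : 2 ≤ d) (a : ℕ × ℕ) (b : Bool) :
    (latticeGraph d).Adj (planePoint d a) (planePoint d (step a b)) := by
  have hb : b.toNat < d := b.toNat_lt.trans_le hd
  have hcoord : ∀ i, (planePoint d a i - planePoint d (step a b) i) ^ 2 =
      if i = ⟨b.toNat, hb⟩ then 1 else 0 := fun i => by
    cases b <;> simp only [planePoint, step, Fin.ext_iff] <;> split_ifs <;> simp_all
  simp [latticeGraph, hcoord]

theorem planePoint_bounds {d n : ℕ} (hn : 0 < n) {a : ℕ × ℕ} (ha : InDouble n a) (i : Fin d) :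
    0 ≤ planePoint d a i ∧ planePoint d a i < 2 * n := by
  simp only [InDouble, InBlock, Nat.div_eq_iff hn] at ha
  unfold planePoint
  split_ifs <;> omega

theorem le_and_le_of_adj {d : ℕ} {x y : Fin d → ℤ} (h : (latticeGraph d).Adj x y) (i : Fin d) :
    x i - 1 ≤ y i ∧ y i ≤ x i + 1 := by
  have hsum : ∑ i, (x i - y i) ^ 2 = 1 := h
  have hsq : (x i - y i) ^ 2 ≤ 1 := hsum ▸ Finset.single_le_sum
    (f := fun i => (x i - y i) ^ 2) (fun i _ => sq_nonneg _) (Finset.mem_univ i)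
  have := abs_le.mp ((sq_le_one_iff_abs_le_one _).mp hsq)
  omega

/-- The two adjacent squares in the coordinate plane. -/
def planeBlock {d : ℕ} (hd : 2 ≤ d) (n : ℕ) : DoubleBlock (latticeGraph d) n where
  P := planePoint d
  edge g := ⟨s(planePoint d g.1, planePoint d (step g.1 g.2)),
    latticeGraph_adj_planePoint_step hd g.1 g.2⟩
  inj _ _ _ _ h := planePoint_injective hd h
  edge_eq _ _ := rfl

variable {d n : ℕ} {hd : 2 ≤ d}

theorem touching_bounds (hn : 0 < n) {e : (latticeGraph d).edgeSet}
    (he : e ∈ (planeBlock hd n).touching) {x : Fin d → ℤ} (hx : x ∈ (e : Sym2 (Fin d → ℤ)))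
    (i : Fin d) : -1 ≤ x i ∧ x i ≤ 2 * n := by
  obtain ⟨a, ha, hae⟩ := he
  have hbounds := planePoint_bounds (d := d) hn ha i
  obtain rfl | hne := eq_or_ne x (planePoint d a)
  · omega
  · have hadj : (latticeGraph d).Adj x (planePoint d a) := by
      rw [← SimpleGraph.mem_edgeSet, ← (Sym2.mem_and_mem_iff hne).mp ⟨hx, hae⟩]
      exact e.2
    have := le_and_le_of_adj hadj i
    omega

theorem finite_touching (hd : 2 ≤ d) (hn : 0 < n) : (planeBlock hd n).touching.Finite := by
  refine Set.Finite.of_finite_image (f := Subtype.val) (Set.Finite.subset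
    (Finset.finite_toSet (Finset.Icc (fun _ : Fin d => -1) (fun _ => (2 * n : ℤ))).sym2) ?_)
    Subtype.val_injective.injOn
  rintro _ ⟨e, he, rfl⟩
  simp only [Finset.mem_coe, Finset.mem_sym2_iff, Finset.mem_Icc]
  exact fun x hx => ⟨fun i => (touching_bounds hn he hx i).1,
    fun i => (touching_bounds hn he hx i).2⟩

/-- Translation of the lattice by the vector `(w, …, w)`. -/
def shift (d w : ℕ) : latticeGraph d ≃g latticeGraph d where
  toEquiv := Equiv.addRight (fun _ => (w : ℤ))
  map_rel_iff' := by simp [latticeGraph]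

/-- Translation of the edges of the lattice. -/
def shiftEdge (d w : ℕ) : (latticeGraph d).edgeSet ≃ (latticeGraph d).edgeSet :=
  (shift d w).mapEdgeSet

theorem shiftEdge_touching_injective (hn : 0 < n) :
    Function.Injective fun p : ℕ × (planeBlock hd n).touching =>
      shiftEdge d (p.1 * (2 * n + 2)) p.2 := by
  rintro ⟨j, e, he⟩ ⟨j', e', he'⟩ (heq : shiftEdge d _ e = shiftEdge d _ e')
  suffices j = j' by
    obtain rfl := this
    obtain rfl := (shiftEdge d _).injective heq
    rfl
  obtain ⟨a, -, hae⟩ := id he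
  replace hae : planePoint d a ∈ (e : Sym2 (Fin d → ℤ)) := hae
  have hval : Sym2.map (shift d (j * (2 * n + 2))) e = Sym2.map (shift d (j' * (2 * n + 2))) e' :=
    congrArg Subtype.val heq
  have hmem : shift d (j * (2 * n + 2)) (planePoint d a) ∈
      Sym2.map (shift d (j' * (2 * n + 2))) e' :=
    hval ▸ Sym2.mem_map.mpr ⟨_, hae, rfl⟩
  obtain ⟨x, hx, hxa⟩ := Sym2.mem_map.mp hmem
  have hbounds := touching_bounds hn he hae ⟨0, by omega⟩
  have hbounds' := touching_bounds hn he' hx ⟨0, by omega⟩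
  have hcoord : x ⟨0, by omega⟩ + j' * (2 * n + 2) =
      planePoint d a ⟨0, by omega⟩ + j * (2 * n + 2) := by
    exact_mod_cast congrFun hxa ⟨0, by omega⟩
  have hjj' : (j' : ℤ) < j + 1 := by nlinarith
  have hj'j : (j : ℤ) < j' + 1 := by nlinarith
  omega

/-- The box `Λ_L`, translated back by `(w, …, w)`. -/
def boxUnshift (d w L : ℕ) : boxGraph d L ↪g latticeGraph d :=
  (shift d w).symm.toEmbedding.comp
    (SimpleGraph.Embedding.comap (Function.Embedding.subtype _) (latticeGraph d))

theorem boxCouplings_eq (J : (latticeGraph d).edgeSet → ℝ) (w L : ℕ) (e : (boxGraph d L).edgeSet) :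
    boxCouplings J L e = J (shiftEdge d w ((boxUnshift d w L).mapEdgeSet e)) := by
  obtain ⟨e, he⟩ := e
  refine congrArg J (Subtype.ext ?_)
  induction e with
  | _ x y => exact (congrArg₂ (s(·, ·)) ((shift d w).apply_symm_apply x.1)
      ((shift d w).apply_symm_apply y.1)).symm

theorem planePoint_mem_range_boxUnshift {w L : ℕ} (hn : 0 < n) (hL : w + 2 * n ≤ L) {a : ℕ × ℕ}
    (ha : InDouble n a) : planePoint d a ∈ Set.range (boxUnshift d w L) := by
  have hbox : shift d w (planePoint d a) ∈ box d L := by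
    have hcoord (i : Fin d) : shift d w (planePoint d a) i = planePoint d a i + w := rfl
    simp only [box, Finset.mem_Icc, Pi.le_def, hcoord]
    constructor <;> intro i <;> have := planePoint_bounds hn ha i <;> omega
  exact ⟨⟨_, hbox⟩, (shift d w).symm_apply_apply _⟩

theorem isSlow_box {k w L : ℕ} (hd : 2 ≤ d) (hk : 0 < k) {β h ε : ℝ} (hβ : 0 ≤ β) (hh : 0 < h)
    (hε : 0 ≤ ε) (hcard : (planeBlock hd (side k)).touching.ncard * ε ≤ 1)
    (hexp : 2 * (1 / 2 : ℝ) ^ (4 * k + 25) ≤ Real.exp (-3 * (h * side k)))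
    (hgap : gapBound (h * side k) < 1) {J : (latticeGraph d).edgeSet → ℝ}
    (hJ : ∀ e ∈ (planeBlock hd (side k)).touching,
      (planeBlock hd (side k)).Fits h ε e (β * J (shiftEdge d w e)))
    (hL : w + 2 * side k ≤ L) :
    IsSlow (swMatrix (boxGraph d L) (boxCouplings J L) β)
      (gibbs (boxGraph d L) (boxCouplings J L) β) (gapBound (h * side k)) := by
  obtain ⟨B, hB⟩ := DoubleBlock.exists_isComap (boxUnshift d w L) (planeBlock hd (side k))
    (side_pos k) fun a ha => planePoint_mem_range_boxUnshift (side_pos k) hL ha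
  have hncard : (B.touching.ncard : ℝ) ≤ (planeBlock hd (side k)).touching.ncard := by
    exact_mod_cast hB.ncard_touching_le (finite_touching hd (side_pos k))
  have hfrustrated : B.IsFrustrated (boxCouplings J L) β h (2 ^ 84 - 1) :=
    .of_fits (even_side hk) hβ hε (hcard.trans' (by gcongr)) fun e he => by
      rw [boxCouplings_eq J w]
      exact hB.fits (hJ _ (hB.map_mem_touching he))
  convert hfrustrated.isSlow hβ hh hexp hgap

end Lattice

/-! ### Almost sure slowness of large boxes -/

section RarePatterns

open Filter MeasureTheory ProbabilityTheory

theorem infinitePi_forall_mem {E I X : Type*} [MeasurableSpace X] (Q : Measure X)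
    [IsProbabilityMeasure Q] {ι : I → E} (hι : Function.Injective ι) {O : I → Set X}
    (hO : ∀ i, MeasurableSet (O i)) (s : Finset I) :
    Measure.infinitePi (fun _ : E => Q) {J | ∀ i ∈ s, J (ι i) ∈ O i} = ∏ i ∈ s, Q (O i) := by
  have hindep : iIndepFun (fun i (J : E → X) => J (ι i)) (Measure.infinitePi fun _ : E => Q) :=
    (iIndepFun_infinitePi (X := fun _ x => x) fun _ => measurable_id).precomp hι
  have hinter := hindep.measure_inter_preimage_eq_mul s fun i _ => hO i
  have hmarginal (i : I) :
      Measure.infinitePi (fun _ : E => Q) ((fun J => J (ι i)) ⁻¹' O i) = Q (O i) := by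
    rw [← Measure.map_apply (measurable_pi_apply _) (hO i)]
    exact congrArg (· (O i)) (Measure.infinitePi_map_eval (fun _ : E => Q) (ι i))
  rw [← Finset.prod_congr rfl fun i _ => hmarginal i, ← hinter]
  congr 1
  ext J
  simp

theorem ae_exists_forall_mem {E F X : Type*} [Finite F] [MeasurableSpace X] (Q : Measure X)
    [IsProbabilityMeasure Q] {ι : ℕ × F → E} (hι : Function.Injective ι) {O : F → Set X}
    (hO : ∀ f, MeasurableSet (O f)) (hpos : ∀ f, Q (O f) ≠ 0) :
    ∀ᵐ J ∂Measure.infinitePi fun _ : E => Q, ∃ j, ∀ f, J (ι (j, f)) ∈ O f := by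
  cases nonempty_fintype F
  set μ := Measure.infinitePi fun _ : E => Q
  let A (j : ℕ) : Set (E → X) := {J | ∀ f, J (ι (j, f)) ∈ O f}
  have hA (j : ℕ) : MeasurableSet (A j) := by
    simp only [A, Set.ofPred_forall]
    exact MeasurableSet.iInter fun f => measurable_pi_apply _ (hO f)
  have hinter (s : Finset ℕ) : μ (⋂ j ∈ s, A j) = ∏ _j ∈ s, ∏ f, Q (O f) := by
    rw [← Finset.prod_product' s Finset.univ fun _ f => Q (O f),
      ← infinitePi_forall_mem Q hι (fun p => hO p.2)]
    congr 1
    ext J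
    simp only [A, Set.mem_iInter, Set.mem_ofPred_eq, Finset.mem_product, Finset.mem_univ, and_true,
      Prod.forall]
    exact forall_congr' fun j => forall_comm
  have hμA (j : ℕ) : μ (A j) = ∏ f, Q (O f) := by simpa using hinter {j}
  have hindep : iIndepSet A μ := by
    simp only [iIndepSet_iff_meas_biInter hA, hinter, hμA, implies_true]
  have hsum : ∑' j, μ (A j) = ∞ := by
    simp only [hμA]
    exact ENNReal.tsum_const_eq_top_of_ne_zero (Finset.prod_ne_zero_iff.mpr fun f _ => hpos f)
  have hlimsup : ∀ᵐ J ∂μ, J ∈ limsup A atTop :=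
    (mem_ae_iff_prob_eq_one (.measurableSet_limsup hA)).mpr (measure_limsup_eq_one hA hindep hsum)
  filter_upwards [hlimsup] with J hJ
  exact (mem_limsup_iff_frequently_mem.mp hJ).exists

end RarePatterns

namespace DoubleBlock

open MeasureTheory

theorem exists_isOpen_fits {V : Type*} {G : SimpleGraph V} {n : ℕ} (B : DoubleBlock G n)
    {Q : Measure ℝ} {a β h ε : ℝ} (hβ : 0 < β) (hh : 0 < h) (hε : 0 < ε) (ha : a ∈ Q.support)
    (haβ : 50 < β * a) (hzero : 0 ∈ Q.support) (hpos : h / β ∈ Q.support)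
    (hneg : -(h / β) ∈ Q.support) (e : G.edgeSet) :
    ∃ O : Set ℝ, IsOpen O ∧ Q O ≠ 0 ∧ ∀ x ∈ O, B.Fits h ε e (β * x) := by
  have hne {O : Set ℝ} {x : ℝ} (hO : IsOpen O) (hxO : x ∈ O) (hx : x ∈ Q.support) : Q O ≠ 0 :=
    ((Measure.mem_support_iff_forall x).mp hx O (hO.mem_nhds hxO)).ne'
  by_cases hstrong : ∃ g, StrongEdge n g ∧ e = B.edge g
  · obtain ⟨g, hg, rfl⟩ := hstrong
    have hopen : IsOpen {x : ℝ | 50 < β * x} := isOpen_lt continuous_const (by fun_prop)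
    exact ⟨_, hopen, hne hopen haβ ha, fun x hx => B.fits_strong hg hx⟩
  by_cases hlink : ∃ t < n, e = B.edge (linkEdge n t)
  · obtain ⟨t, ht, rfl⟩ := hlink
    have hopen : IsOpen {x : ℝ | |β * x - linkSign n t * h| < h / 100} :=
      isOpen_lt (by fun_prop) continuous_const
    have hmem : linkSign n t * (h / β) ∈ Q.support := by
      obtain hsign | hsign := linkSign_eq n t <;> rw [hsign] <;> simpa
    refine ⟨_, hopen, hne hopen ?_ hmem, fun x hx => B.fits_link ht hx.le⟩
    have hcenter : β * (linkSign n t * (h / β)) - linkSign n t * h = 0 := by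
      field_simp
      ring
    simpa only [Set.mem_ofPred_eq, hcenter, abs_zero] using by positivity
  · have hopen : IsOpen {x : ℝ | |β * x| < ε} := isOpen_lt (by fun_prop) continuous_const
    exact ⟨_, hopen, hne hopen (by simpa) hzero, fun x hx =>
      B.fits_weak (fun g hg heq => hstrong ⟨g, hg, heq⟩) (fun t ht heq => hlink ⟨t, ht, heq⟩) hx.le⟩

end DoubleBlock

section SlowBoxes

open MeasureTheory Filter Topology

variable {d : ℕ}

theorem ae_exists_shift_fits (hd : 2 ≤ d) {n : ℕ} (hn : 0 < n) {Q : Measure ℝ}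
    [IsProbabilityMeasure Q] {a β h ε : ℝ} (hβ : 0 < β) (hh : 0 < h) (hε : 0 < ε)
    (ha : a ∈ Q.support) (haβ : 50 < β * a) (hzero : 0 ∈ Q.support) (hpos : h / β ∈ Q.support)
    (hneg : -(h / β) ∈ Q.support) :
    ∀ᵐ J ∂Measure.infinitePi fun _ : (latticeGraph d).edgeSet => Q, ∃ w,
      ∀ e ∈ (planeBlock hd n).touching, (planeBlock hd n).Fits h ε e (β * J (shiftEdge d w e)) := by
  have := (finite_touching hd hn).to_subtype
  choose O hopen hQO hfits using
    (planeBlock hd n).exists_isOpen_fits hβ hh hε ha haβ hzero hpos hneg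
  filter_upwards [ae_exists_forall_mem Q (shiftEdge_touching_injective (hd := hd) hn)
    (fun e => (hopen e).measurableSet) fun e => hQO e] with J ⟨j, hj⟩
  exact ⟨_, fun e he => hfits e _ (hj ⟨e, he⟩)⟩

theorem boxSpectralRadius_le_one (J : (latticeGraph d).edgeSet → ℝ) {β : ℝ} (hβ : 0 ≤ β)
    (L : ℕ) : boxSpectralRadius J β L ≤ 1 := by
  unfold boxSpectralRadius
  convert IsReversibleChain.secondSpectralRadius_le_one (isReversibleChain_swMatrix hβ)

theorem exists_side {Q : Measure ℝ} (hQ : 0 ∈ interior Q.support) {β : ℝ} (M : ℝ) :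
    ∃ k, 0 < k ∧ 2 * (1 / 2 : ℝ) ^ (4 * k + 25) ≤ Real.exp (-3 * M) ∧
      M / side k / β ∈ Q.support ∧ -(M / side k / β) ∈ Q.support := by
  have hside : Tendsto (fun k => (side k : ℝ)) atTop atTop :=
    tendsto_natCast_atTop_atTop.comp <|
      tendsto_atTop_mono (fun k => (Nat.le_succ k).trans (succ_le_side k)) tendsto_id
  have hlink : Tendsto (fun k => M / side k / β) atTop (𝓝 0) := by
    simpa using (hside.const_div_atTop M).div_const β
  have hneg : Tendsto (fun k => -(M / side k / β)) atTop (𝓝 0) := by simpa using hlink.neg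
  have hsupport : ∀ᶠ x in 𝓝 (0 : ℝ), x ∈ Q.support := mem_interior_iff_mem_nhds.mp hQ
  have hpow : Tendsto (fun k : ℕ => 2 * (1 / 2 : ℝ) ^ (4 * k + 25)) atTop (𝓝 0) := by
    have hexponent : Tendsto (fun k : ℕ => 4 * k + 25) atTop atTop :=
      tendsto_atTop_mono (fun k => by dsimp; omega) tendsto_id
    simpa using ((tendsto_pow_atTop_nhds_zero_of_lt_one (by norm_num)
      (by norm_num : (1 / 2 : ℝ) < 1)).comp hexponent).const_mul 2
  exact ((eventually_gt_atTop 0).and <|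
    (hpow.eventually_le_const (Real.exp_pos _)).and <|
    (hlink.eventually hsupport).and (hneg.eventually hsupport)).exists

theorem ae_eventually_isSlow (hd : 2 ≤ d) {Q : Measure ℝ} [IsProbabilityMeasure Q]
    (hQ : 0 ∈ interior Q.support) {a β M : ℝ} (ha : a ∈ Q.support) (hβ : 0 < β)
    (haβ : 50 < β * a) (hM : 0 < M) (hgap : gapBound M < 1) :
    ∀ᵐ J ∂Measure.infinitePi fun _ : (latticeGraph d).edgeSet => Q, ∀ᶠ L : ℕ in atTop,
      IsSlow (swMatrix (boxGraph d L) (boxCouplings J L) β)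
        (gibbs (boxGraph d L) (boxCouplings J L) β) (gapBound M) := by
  obtain ⟨k, hk, hexp, hpos, hneg⟩ := exists_side hQ (β := β) M
  have hside : (0 : ℝ) < side k := by exact_mod_cast side_pos k
  have hM' : M / side k * side k = M := div_mul_cancel₀ _ hside.ne'
  have hh : 0 < M / side k := by positivity
  set N : ℝ := ((planeBlock hd (side k)).touching.ncard : ℝ)
  have hN : 0 ≤ N := Nat.cast_nonneg _
  have hcard : N * (1 / (N + 1)) ≤ 1 := by
    rw [mul_one_div, div_le_one (by positivity)]
    linarith
  filter_upwards [ae_exists_shift_fits hd (side_pos k) hβ hh (by positivity : 0 < 1 / (N + 1)) ha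
    haβ (interior_subset hQ) hpos hneg] with J ⟨w, hw⟩
  filter_upwards [eventually_ge_atTop (w + 2 * side k)] with L hL
  rw [← hM'] at hexp hgap ⊢
  exact isSlow_box hd hk hβ.le hh (by positivity) hcard hexp hgap hw hL

theorem tendsto_gapBound : Tendsto (fun m : ℕ => gapBound m) atTop (𝓝 0) := by
  have hexponent : Tendsto (fun m : ℕ => 2 - 4 / 10 * (m : ℝ)) atTop atBot :=
    tendsto_atBot_add_const_left _ 2 <| tendsto_neg_atTop_atBot.comp <|
      tendsto_natCast_atTop_atTop.const_mul_atTop (by norm_num)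
  simpa [gapBound] using (Real.tendsto_exp_atBot.comp hexponent).const_mul 16

theorem tendsto_inv_neg_log_one_sub {η : ℕ → ℝ} (hη : Tendsto η atTop (𝓝 0)) :
    Tendsto (fun m => (ENNReal.ofReal (-Real.log (1 - η m)))⁻¹) atTop (𝓝 ⊤) := by
  have hlog : Tendsto (fun m => -Real.log (1 - η m)) atTop (𝓝 0) := by
    simpa using ((hη.const_sub 1).log (by norm_num)).neg
  simpa using tendsto_inv_iff.mpr (ENNReal.tendsto_ofReal hlog)

end SlowBoxes

end SwendsenWang

end

open Filter MeasureTheory SwendsenWang Topology in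
theorem theorem4p8_general {d : ℕ} (hd : 2 ≤ d) {Q : Measure ℝ} [IsProbabilityMeasure Q]
    (hQ : 0 ∈ interior Q.support) {a β : ℝ} (ha : a ∈ Q.support) (hβ : 0 < β)
    (haβ : 50 < β * a) :
    ∀ᵐ J ∂Measure.infinitePi fun _ : (latticeGraph d).edgeSet => Q,
      Tendsto (boxSpectralRadius J β) atTop (𝓝 1) ∧ Tendsto (boxExpTime J β) atTop (𝓝 ⊤) := by
  have hgap : ∀ᶠ m : ℕ in atTop, 0 < m ∧ gapBound m < 1 :=
    (eventually_gt_atTop 0).and (tendsto_gapBound.eventually_lt_const one_pos)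
  have hslow : ∀ᵐ J ∂Measure.infinitePi fun _ : (latticeGraph d).edgeSet => Q,
      ∀ m : ℕ, 0 < m ∧ gapBound m < 1 → ∀ᶠ L : ℕ in atTop,
        IsSlow (swMatrix (boxGraph d L) (boxCouplings J L) β)
          (gibbs (boxGraph d L) (boxCouplings J L) β) (gapBound m) :=
    ae_all_iff.mpr fun m => eventually_imp_distrib_left.mpr fun ⟨hm, hm1⟩ =>
      ae_eventually_isSlow hd hQ ha hβ haβ (by exact_mod_cast hm) hm1
  filter_upwards [hslow] with J hJ
  refine ⟨tendsto_order.mpr ⟨fun r hr => ?_, fun r hr => ?_⟩,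
    tendsto_order.mpr ⟨fun r hr => ?_, fun r hr => absurd hr not_top_lt⟩⟩
  · have hlim : Tendsto (fun m : ℕ => 1 - gapBound m) atTop (𝓝 1) := by
      simpa using tendsto_gapBound.const_sub 1
    obtain ⟨m, hm, hrm⟩ := (hgap.and (hlim.eventually_const_lt hr)).exists
    filter_upwards [hJ m hm] with L hL using hrm.trans_le hL.le_secondSpectralRadius
  · exact .of_forall fun L => (boxSpectralRadius_le_one J hβ.le L).trans_lt hr
  · obtain ⟨m, hm, hrm⟩ :=
      (hgap.and ((tendsto_inv_neg_log_one_sub tendsto_gapBound).eventually_const_lt hr)).exists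
    filter_upwards [hJ m hm] with L hL using hrm.trans_le hL.le_expTime

theorem theorem4p8 (d : ℕ) (hd : 2 ≤ d) (Q : MeasureTheory.Measure ℝ)
    [MeasureTheory.IsProbabilityMeasure Q]
    (hQ : (0 : ℝ) ∈ interior Q.support) (δ : ℝ) (hδ : δ ∈ Set.Ioo (0 : ℝ) (1 / 2)) :
    ∃ β₀ : ℝ, 0 < β₀ ∧ ∀ β : ℝ, β₀ < β →
      ∀ᵐ J ∂(MeasureTheory.Measure.infinitePi
          fun _ : (SwendsenWang.latticeGraph d).edgeSet => Q),
        Filter.Tendsto (fun L : ℕ => SwendsenWang.boxSpectralRadius J β L)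
          Filter.atTop (nhds 1) ∧
        Filter.Tendsto (fun L : ℕ => SwendsenWang.boxExpTime J β L)
          Filter.atTop (nhds ⊤) := by
  have hsupport : ∀ᶠ a in nhdsWithin (0 : ℝ) (Set.Ioi 0), a ∈ Q.support :=
    Filter.Eventually.filter_mono nhdsWithin_le_nhds (mem_interior_iff_mem_nhds.mp hQ)
  obtain ⟨a, haQ, ha : 0 < a⟩ := (hsupport.and self_mem_nhdsWithin).exists
  exact ⟨50 / a, by positivity, fun β hβ => theorem4p8_general hd hQ haQ
    ((by positivity : 0 < 50 / a).trans hβ) ((div_lt_iff₀ ha).mp hβ)⟩
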